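/- **Setting.** Let $\mathcal Z\subset\mathbb R^d$ be measurable, $\nu$ a measure on $\mathbb R^d$ (e.g. Lebesgue or counting measure), $\Theta\subset\mathbb R^p$, and let $f(\cdot;\theta)$, $\theta\in\Theta$, be probability densities on $\mathcal Z$ with respect to $\nu$. Let $\mathbf z_1,\mathbf z_2,\dots$ be i.i.d. with density $f(\cdot;\theta_0)$. Let $\tilde f_r(\mathbf z;\theta)$, $r\in\mathbb N$, be (possibly random) real-valued approximations of $f(\mathbf z;\theta)$, let $R:\mathbb N\to\mathbb N$, and let the maximum approximated likelihood estimator $\hat\theta^{(n)}_{MAL}$ be a random vector which, with probability tending to one, lies in $\Theta$ and maximizes $$\tilde L_n(\theta)=\frac1n\sum_{i=1}^n\log\tilde f_{R(n)}(\mathbf z_i;\theta)$$ over $\theta\in\Theta$. Write $\nabla_\theta$ and $\nabla_{\theta\theta}$ for the gradient and the Hessian in $\theta$, $\|\cdot\|$ for the $\ell_2$-norm (spectral norm for matrices), and $$\mathcal E(r)=\sup_{\mathbf z\in\mathcal Z,\theta\in\Theta}\bigl|\tilde f_r(\mathbf z;\theta)-f(\mathbf z;\theta)\bigr|+\sup_{\mathbf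 z\in\mathcal Z,\theta\in\Theta}\bigl\|\nabla_\theta\tilde f_r(\mathbf z;\theta)-\nabla_\theta f(\mathbf z;\theta)\bigr\| ,$$ where suprema of derivatives over $\Theta$ are taken over its interior points, and "twice continuously differentiable on $\Theta$" means continuous on $\Theta$ and $C^2$ in its interior. **Theorem.** Assume the classical conditions for asymptotic normality of maximum likelihood, with $\mathbf z$ denoting a random vector with density $f(\cdot;\theta_0)$: 1. $f(\cdot;\theta)$ is not $\nu$-a.e. equal to $f(\cdot;\theta_0)$ on $\mathcal Z$ for every $\theta\in\Theta$, $\theta\ne\theta_0$; 2. $\Theta$ is compact and $\theta_0$ lies in the interior of $\Theta$; 3. at each $\theta\in\Theta$, $\log f(\mathbf z;\cdot)$ is continuous with probability one, and $\mathbb E\bigl[\sup_{\theta\in\Theta}|\log f(\mathbf z;\theta)|\bigr]<\infty$; 4. there is an open neighbourhood $\mathcal N\subset\Theta$ of $\theta_0$ on which, for all $\mathbf y\in\mathcal Z$, $f(\mathbf y;\cdot)$ is twice continuously differentiable and positive, with $\int_{\mathcal Z}\sup_{\theta\in\mathcal N}\|\nabla_\theta f(\mathbf y;\theta)\|\,d\nu(\mathbf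 y)<\infty$, $\int_{\mathcal Z}\sup_{\theta\in\mathcal N}\|\nabla_{\theta\theta}f(\mathbf y;\theta)\|\,d\nu(\mathbf y)<\infty$ and $\mathbb E\bigl[\sup_{\theta\in\mathcal N}\|\nabla_{\theta\theta}\log f(\mathbf z;\theta)\|\bigr]<\infty$; 5. the Fisher information $\mathcal I=\mathbb E\bigl[\nabla_\theta\log f(\mathbf z;\theta_0)\,(\nabla_\theta\log f(\mathbf z;\theta_0))^T\bigr]$ exists and is nonsingular. Assume the conditions for consistency of the approximated estimator: 6. there is $\bar\delta>0$ with $f(\mathbf z;\theta)\ge\bar\delta$ for all $\mathbf z\in\mathcal Z$, $\theta\in\Theta$; 7. $\sup_{\mathbf z\in\mathcal Z,\theta\in\Theta}|\tilde f_r(\mathbf z;\theta)-f(\mathbf z;\theta)|\to0$ as $r\to\infty$ (in probability, if $\tilde f_r$ is random); 8. $R$ is monotonically increasing and $R(n)\to\infty$. Assume moreover: - (i) almost surely, $\tilde f_r(\mathbf z;\cdot)$ is twice continuously differentiable and bounded on $\Theta$ for all $\mathbf z\in\mathcal Z$ and $r\in\mathbb N$; - (ii) $\sqrt n\,\mathcal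 E(R(n))\to0$ in probability; - (iii) $\sup_{\mathbf z\in\mathcal Z,\theta\in\Theta}\|\nabla_{\theta\theta}\tilde f_{R(n)}(\mathbf z;\theta)-\nabla_{\theta\theta}f(\mathbf z;\theta)\|\to0$ in probability. Then $$\sqrt n\,\bigl(\hat\theta^{(n)}_{MAL}-\theta_0\bigr)\xrightarrow{\;d\;}N(0,\mathcal I^{-1})\qquad(n\to\infty).$$ -/

import Mathlib

open MeasureTheory ProbabilityTheory Filter Topology
open scoped ENNReal

noncomputable section

/-- The Hessian of `g : ℝ^p → ℝ` at `θ`, as the derivative of the gradient field.  Its operator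
norm is the `ℓ²` (spectral) norm of the matrix of second partial derivatives. -/
def hessian {p : ℕ} (g : EuclideanSpace ℝ (Fin p) → ℝ) (θ : EuclideanSpace ℝ (Fin p)) :
    EuclideanSpace ℝ (Fin p) →L[ℝ] EuclideanSpace ℝ (Fin p) :=
  fderiv ℝ (gradient g) θ

/-- `f z θ`, `θ ∈ Θ`, is a family of probability densities on the sample space `Z ⊆ ℝ^d` with
respect to the dominating measure `ν` (for instance Lebesgue or counting measure). -/
structure IsDensityFamily {d p : ℕ} (ν : Measure (EuclideanSpace ℝ (Fin d)))
    (Z : Set (EuclideanSpace ℝ (Fin d))) (Θ : Set (EuclideanSpace ℝ (Fin p)))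
    (f : EuclideanSpace ℝ (Fin d) → EuclideanSpace ℝ (Fin p) → ℝ) : Prop where
  measurableSet : MeasurableSet Z
  aemeasurable : ∀ θ ∈ Θ, AEMeasurable (fun z => f z θ) (ν.restrict Z)
  nonneg : ∀ z ∈ Z, ∀ θ ∈ Θ, 0 ≤ f z θ
  lintegral_eq_one : ∀ θ ∈ Θ, ∫⁻ z in Z, ENNReal.ofReal (f z θ) ∂ν = 1

/-- The law on `Z` with density `f z θ₀` with respect to `ν`. -/
def modelLaw {d p : ℕ} (ν : Measure (EuclideanSpace ℝ (Fin d)))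
    (Z : Set (EuclideanSpace ℝ (Fin d)))
    (f : EuclideanSpace ℝ (Fin d) → EuclideanSpace ℝ (Fin p) → ℝ)
    (θ₀ : EuclideanSpace ℝ (Fin p)) : Measure (EuclideanSpace ℝ (Fin d)) :=
  (ν.restrict Z).withDensity (fun z => ENNReal.ofReal (f z θ₀))

/-- The classical conditions for consistency of the maximum likelihood estimator. -/
structure MLConsistencyConditions {d p : ℕ} (ν : Measure (EuclideanSpace ℝ (Fin d)))
    (Z : Set (EuclideanSpace ℝ (Fin d))) (Θ : Set (EuclideanSpace ℝ (Fin p)))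
    (f : EuclideanSpace ℝ (Fin d) → EuclideanSpace ℝ (Fin p) → ℝ)
    (θ₀ : EuclideanSpace ℝ (Fin p)) : Prop where
  /-- Identification: different parameters have essentially different densities. -/
  identified : ∀ θ ∈ Θ, θ ≠ θ₀ → ¬ (fun z => f z θ) =ᵐ[ν.restrict Z] (fun z => f z θ₀)
  mem : θ₀ ∈ Θ
  isCompact : IsCompact Θ
  continuous : ∀ θ ∈ Θ, ∀ᵐ z ∂(modelLaw ν Z f θ₀),
    ContinuousWithinAt (fun θ' => Real.log (f z θ')) Θ θ
  dominated : ∫⁻ z, ⨆ θ ∈ Θ, ‖Real.log (f z θ)‖ₑ ∂(modelLaw ν Z f θ₀) < ∞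

/-- The Fisher information matrix `E[∇ log f(z; θ₀) (∇ log f(z; θ₀))ᵀ]`, `z` with density
`f(·; θ₀)`. -/
def fisherInformation {d p : ℕ} (ν : Measure (EuclideanSpace ℝ (Fin d)))
    (Z : Set (EuclideanSpace ℝ (Fin d)))
    (f : EuclideanSpace ℝ (Fin d) → EuclideanSpace ℝ (Fin p) → ℝ)
    (θ₀ : EuclideanSpace ℝ (Fin p)) : Matrix (Fin p) (Fin p) ℝ :=
  Matrix.of fun i j => ∫ z, gradient (fun θ => Real.log (f z θ)) θ₀ i *
    gradient (fun θ => Real.log (f z θ)) θ₀ j ∂(modelLaw ν Z f θ₀)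

/-- The classical conditions for asymptotic normality of the maximum likelihood estimator. -/
structure MLNormalityConditions {d p : ℕ} (ν : Measure (EuclideanSpace ℝ (Fin d)))
    (Z : Set (EuclideanSpace ℝ (Fin d))) (Θ : Set (EuclideanSpace ℝ (Fin p)))
    (f : EuclideanSpace ℝ (Fin d) → EuclideanSpace ℝ (Fin p) → ℝ)
    (θ₀ : EuclideanSpace ℝ (Fin p)) : Prop where
  consistency : MLConsistencyConditions ν Z Θ f θ₀
  mem_interior : θ₀ ∈ interior Θ
  /-- Local conditions on a neighbourhood `N ⊆ Θ` of `θ₀`. -/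
  neighbourhood : ∃ N : Set (EuclideanSpace ℝ (Fin p)), IsOpen N ∧ θ₀ ∈ N ∧ N ⊆ Θ ∧
    (∀ z ∈ Z, ContDiffOn ℝ 2 (f z) N) ∧
    (∀ z ∈ Z, ∀ θ ∈ N, 0 < f z θ) ∧
    ∫⁻ z in Z, ⨆ θ ∈ N, ‖gradient (f z) θ‖ₑ ∂ν < ∞ ∧
    ∫⁻ z in Z, ⨆ θ ∈ N, ‖hessian (f z) θ‖ₑ ∂ν < ∞ ∧
    ∫⁻ z, ⨆ θ ∈ N, ‖hessian (fun θ' => Real.log (f z θ')) θ‖ₑ ∂(modelLaw ν Z f θ₀) < ∞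
  information_exists : ∀ i j, Integrable
    (fun z => gradient (fun θ => Real.log (f z θ)) θ₀ i *
      gradient (fun θ => Real.log (f z θ)) θ₀ j) (modelLaw ν Z f θ₀)
  information_nonsingular : (fisherInformation ν Z f θ₀).det ≠ 0

/-- `sup_{z ∈ Z, θ ∈ Θ} |g(z; θ) - f(z; θ)|`, as an extended nonnegative number. -/
def valueError {d p : ℕ} (Z : Set (EuclideanSpace ℝ (Fin d))) (Θ : Set (EuclideanSpace ℝ (Fin p)))
    (g f : EuclideanSpace ℝ (Fin d) → EuclideanSpace ℝ (Fin p) → ℝ) : ℝ≥0∞ :=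
  ⨆ z ∈ Z, ⨆ θ ∈ Θ, ‖g z θ - f z θ‖ₑ

/-- `sup_{z, θ} ‖∇g(z; θ) - ∇f(z; θ)‖`, taken over the interior points `θ` of `Θ`, where the
gradient of a function defined on `Θ` makes sense. -/
def gradientError {d p : ℕ} (Z : Set (EuclideanSpace ℝ (Fin d)))
    (Θ : Set (EuclideanSpace ℝ (Fin p)))
    (g f : EuclideanSpace ℝ (Fin d) → EuclideanSpace ℝ (Fin p) → ℝ) : ℝ≥0∞ :=
  ⨆ z ∈ Z, ⨆ θ ∈ interior Θ, ‖gradient (g z) θ - gradient (f z) θ‖ₑ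

/-- `sup_{z, θ} ‖∇²g(z; θ) - ∇²f(z; θ)‖`, taken over the interior points `θ` of `Θ`. -/
def hessianError {d p : ℕ} (Z : Set (EuclideanSpace ℝ (Fin d)))
    (Θ : Set (EuclideanSpace ℝ (Fin p)))
    (g f : EuclideanSpace ℝ (Fin d) → EuclideanSpace ℝ (Fin p) → ℝ) : ℝ≥0∞ :=
  ⨆ z ∈ Z, ⨆ θ ∈ interior Θ, ‖hessian (g z) θ - hessian (f z) θ‖ₑ

/-- The worst-case approximation error of `f` and its gradient by `g` and its gradient. -/
def approxError {d p : ℕ} (Z : Set (EuclideanSpace ℝ (Fin d)))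
    (Θ : Set (EuclideanSpace ℝ (Fin p)))
    (g f : EuclideanSpace ℝ (Fin d) → EuclideanSpace ℝ (Fin p) → ℝ) : ℝ≥0∞ :=
  valueError Z Θ g f + gradientError Z Θ g f

/-- The average log-likelihood `(1/n) ∑_{i < n} log g(x_i; θ)`. -/
def logLikelihood {d p : ℕ} (g : EuclideanSpace ℝ (Fin d) → EuclideanSpace ℝ (Fin p) → ℝ)
    (x : ℕ → EuclideanSpace ℝ (Fin d)) (n : ℕ) (θ : EuclideanSpace ℝ (Fin p)) : ℝ :=
  (1 / (n : ℝ)) * ∑ i ∈ Finset.range n, Real.log (g (x i) θ)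

/-- The conditions for consistency of the maximum approximated likelihood estimator.  The
approximations `ft r ω` may be random (Monte Carlo), whence the convergence in probability; for
nonrandom approximations it is ordinary convergence. -/
structure MALConsistencyConditions {d p : ℕ} {Ω : Type*} [MeasurableSpace Ω] (P : Measure Ω)
    (ν : Measure (EuclideanSpace ℝ (Fin d)))
    (Z : Set (EuclideanSpace ℝ (Fin d))) (Θ : Set (EuclideanSpace ℝ (Fin p)))
    (f : EuclideanSpace ℝ (Fin d) → EuclideanSpace ℝ (Fin p) → ℝ)
    (θ₀ : EuclideanSpace ℝ (Fin p))
    (ft : ℕ → Ω → EuclideanSpace ℝ (Fin d) → EuclideanSpace ℝ (Fin p) → ℝ)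
    (R : ℕ → ℕ) : Prop where
  consistency : MLConsistencyConditions ν Z Θ f θ₀
  bounded_below : ∃ δ : ℝ, 0 < δ ∧ ∀ z ∈ Z, ∀ θ ∈ Θ, δ ≤ f z θ
  uniform_approx : TendstoInMeasure P (fun r ω => valueError Z Θ (ft r ω) f) atTop (fun _ => 0)
  monotone : Monotone R
  tendsto_atTop : Tendsto R atTop atTop

end

/-!
The proof compares the estimator with the *exact* likelihood and only ever expands the latter.

**Consistency.**  Since `f ≥ δ` on `Z × Θ`, a uniform error `e ≤ δ / 2` in the density changes the
average log-likelihood by at most `e / (δ / 2)`, so the estimator asymptotically maximizes the exact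
log-likelihood.  Each `f x` is continuous on `Θ`, being a uniform limit of the approximations, and
Wald's argument applies (`withHighProb_dist_lt_of_approx_max`): by dominated convergence the modulus
of continuity of the log-likelihood at a point has a small mean (`exists_integrable_modulus`), by
Gibbs' inequality (`integral_log_lt_integral_log`) the mean log-likelihood is largest at `θ₀` only,
and `Θ` is compact.

**Approximate root.**  At the estimator `θhat`, an interior point of `Θ` with high probability, the
approximated score vanishes.  It differs from the exact average score by at most
`2 e / δ * (1 + average of ‖∇ log f‖)`, where `e` is the error in value and gradient, and the average
is bounded in probability uniformly near `θ₀`.  As `√n e → 0`, the exact average score at `θhat` is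
`o(n ^ (-1 / 2))` (`withHighProb_sqrt_mul_norm_average_score_lt`).

**Linearization.**  Near `θ₀` the exact average score is its value at `θ₀` plus the linear map
`E[∇² log f] (θ - θ₀)`, up to a small multiple of `‖θ - θ₀‖`; this uses only the law of large
numbers for the modulus of continuity of the Hessian
(`exists_withHighProb_average_linearization`).  Differentiating `∫ f = 1` twice under the integral
sign shows that the score has mean zero and that `E[∇² log f]` is minus the Fisher information
(`integral_score_eq_zero`, `integral_hessian_log_apply`).  Hence `√n (θhat - θ₀)` differs by a term
tending to zero in probability from the inverse information applied to the normalized sum of the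
scores, and the central limit theorem and Slutsky's theorem conclude.

Events are handled through outer measures (`WithHighProb`), because the suprema over `Z × Θ` of the
random approximation errors need not be measurable.
-/

/-! ### Events of probability tending to one -/

/-- The events `{ω | A n ω}` have probability tending to one.  This is phrased through the outer
measure of the complements, so that no measurability of the events is needed. -/
def WithHighProb {Ω : Type*} [MeasurableSpace Ω] (P : Measure Ω) (A : ℕ → Ω → Prop) : Prop :=
  Tendsto (fun n => P {ω | ¬ A n ω}) atTop (𝓝 0)

section HighProb

variable {Ω : Type*} [MeasurableSpace Ω] {P : Measure Ω} {A B : ℕ → Ω → Prop}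

lemma WithHighProb.mono (hA : WithHighProb P A)
    (h : ∀ᶠ n in atTop, ∀ᵐ ω ∂P, A n ω → B n ω) : WithHighProb P B := by
  refine tendsto_of_tendsto_of_tendsto_of_le_of_le' tendsto_const_nhds hA
    (.of_forall fun _ => zero_le) ?_
  filter_upwards [h] with n hn
  refine measure_mono_ae ?_
  filter_upwards [hn] with ω hω hB hA'
  exact hB (hω hA')

lemma WithHighProb.and (hA : WithHighProb P A) (hB : WithHighProb P B) :
    WithHighProb P (fun n ω => A n ω ∧ B n ω) := by
  have h := Tendsto.add hA hB
  rw [add_zero] at h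
  refine tendsto_of_tendsto_of_tendsto_of_le_of_le tendsto_const_nhds h (fun _ => zero_le) ?_
  intro n
  refine le_trans (measure_mono ?_) (measure_union_le _ _)
  intro ω hω
  exact not_and_or.1 hω

lemma WithHighProb.of_ae (h : ∀ᵐ ω ∂P, ∀ n, A n ω) : WithHighProb P A := by
  have h0 : ∀ n, P {ω | ¬ A n ω} = 0 := fun n => ae_iff.1 (h.mono fun ω hω => hω n)
  simp only [WithHighProb, h0, tendsto_const_nhds]

lemma WithHighProb.finset_forall {J : Type*} (t : Finset J) {A : J → ℕ → Ω → Prop}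
    (h : ∀ j ∈ t, WithHighProb P (A j)) : WithHighProb P (fun n ω => ∀ j ∈ t, A j n ω) := by
  classical
  induction t using Finset.induction_on with
  | empty => exact .of_ae (by simp)
  | insert a t _ ih =>
    refine ((h a (Finset.mem_insert_self a t)).and
      (ih fun j hj => h j (Finset.mem_insert_of_mem hj))).mono (.of_forall fun n => .of_forall ?_)
    intro ω hω j hj
    rcases Finset.mem_insert.1 hj with rfl | hj
    · exact hω.1
    · exact hω.2 j hj

lemma withHighProb_norm_sub_lt {F : Type*} [SeminormedAddCommGroup F]
    {X : ℕ → Ω → F} {Y : Ω → F} (h : TendstoInMeasure P X atTop Y) {ε : ℝ} (hε : 0 < ε) :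
    WithHighProb P (fun n ω => ‖X n ω - Y ω‖ < ε) := by
  simpa only [WithHighProb, not_lt] using tendstoInMeasure_iff_norm.1 h ε hε

lemma ENNReal.edist_zero_right (a : ℝ≥0∞) : edist a 0 = a := by
  cases a with
  | top => exact (ENNReal.edist_eq_top_iff _ _).2 (by simp)
  | coe a =>
    change edist a 0 = (a : ℝ≥0∞)
    rw [edist_dist, NNReal.dist_eq]
    simp

lemma withHighProb_lt {X : ℕ → Ω → ℝ≥0∞}
    (h : TendstoInMeasure P X atTop (fun _ => 0)) {ε : ℝ≥0∞} (hε : 0 < ε) :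
    WithHighProb P (fun n ω => X n ω < ε) := by
  simpa only [WithHighProb, not_lt, ENNReal.edist_zero_right] using h ε hε

lemma WithHighProb.exists [IsProbabilityMeasure P] (hA : WithHighProb P A)
    (h : ∀ᵐ ω ∂P, ∀ n, A n ω → B n ω) : ∃ n ω, B n ω := by
  by_contra! hB
  have hB' : WithHighProb P B := hA.mono (.of_forall fun n => h.mono fun ω hω => hω n)
  have h1 : ∀ n, P {ω | ¬ B n ω} = 1 := fun n => by simp [hB n]
  simp only [WithHighProb, h1] at hB'
  exact one_ne_zero (tendsto_nhds_unique tendsto_const_nhds hB')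

/-- The weak law of large numbers for integrable functions of an i.i.d. sample. -/
lemma tendstoInMeasure_average [IsProbabilityMeasure P] {S : Type*} [MeasurableSpace S]
    {μ : Measure S} {z : ℕ → Ω → S} (hz_law : ∀ i, HasLaw (z i) μ P) (hz_indep : iIndepFun z P)
    {F : Type*} [NormedAddCommGroup F] [NormedSpace ℝ F] [CompleteSpace F]
    {h : S → F} (hh : Integrable h μ) :
    TendstoInMeasure P (fun (n : ℕ) ω => (n : ℝ)⁻¹ • ∑ i ∈ Finset.range n, h (z i ω)) atTop
      (fun _ => ∫ x, h x ∂μ) := by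
  borelize F
  have hm : ∀ i, AEMeasurable h (P.map (z i)) := fun i => by
    rw [(hz_law i).map_eq]; exact hh.aestronglyMeasurable.aemeasurable
  have hint : ∀ i, Integrable (fun ω => h (z i ω)) P := fun i => by
    have := hh
    rw [← (hz_law i).map_eq] at this
    exact this.comp_aemeasurable (hz_law i).aemeasurable
  have hid : ∀ i, IdentDistrib (z i) (z 0) P P := fun i =>
    ⟨(hz_law i).aemeasurable, (hz_law 0).aemeasurable,
      (hz_law i).map_eq.trans (hz_law 0).map_eq.symm⟩
  have hmean : ∫ ω, h (z 0 ω) ∂P = ∫ x, h x ∂μ := by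
    rw [← (hz_law 0).map_eq, integral_map (hz_law 0).aemeasurable]
    rw [(hz_law 0).map_eq]; exact hh.aestronglyMeasurable
  have hlln := strong_law_ae (fun i ω => h (z i ω)) (hint 0)
    (fun i j hij => (hz_indep.indepFun hij).comp₀ (hz_law i).aemeasurable
      (hz_law j).aemeasurable (hm i) (hm j))
    (fun i => (hid i).comp_of_aemeasurable (hm i))
  rw [hmean] at hlln
  refine tendstoInMeasure_of_tendsto_ae (fun n => ?_) hlln
  exact (Finset.aestronglyMeasurable_fun_sum _ fun i _ => (hint i).aestronglyMeasurable).const_smul _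

lemma withHighProb_average_lt [IsProbabilityMeasure P] {S : Type*} [MeasurableSpace S]
    {μ : Measure S} {z : ℕ → Ω → S} (hz_law : ∀ i, HasLaw (z i) μ P) (hz_indep : iIndepFun z P)
    {h : S → ℝ} (hh : Integrable h μ) {c : ℝ} (hc : ∫ x, h x ∂μ < c) :
    WithHighProb P (fun n ω => (n : ℝ)⁻¹ * ∑ i ∈ Finset.range n, h (z i ω) < c) := by
  have hlln := tendstoInMeasure_average hz_law hz_indep hh
  have hc' : 0 < c - ∫ x, h x ∂μ := sub_pos.2 hc
  have hwhp := withHighProb_norm_sub_lt hlln hc'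
  refine hwhp.mono (.of_forall fun n => .of_forall fun ω hω => ?_)
  rw [Real.norm_eq_abs, smul_eq_mul] at hω
  linarith [(abs_lt.1 hω).2]

lemma ae_forall_sample {S : Type*} [MeasurableSpace S] {μ : Measure S} {z : ℕ → Ω → S}
    (hz_law : ∀ i, HasLaw (z i) μ P) {p : S → Prop} (hp : ∀ᵐ x ∂μ, p x) :
    ∀ᵐ ω ∂P, ∀ i, p (z i ω) := by
  refine ae_all_iff.2 fun i => ?_
  have h := hp
  rw [← (hz_law i).map_eq] at h
  exact ae_of_ae_map (hz_law i).aemeasurable h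

end HighProb

/-! ### Envelopes and moduli of continuity of random functions -/

section Envelope

variable {S : Type*} [MeasurableSpace S] {μ : Measure S}
  {F : Type*} [NormedAddCommGroup F]

/-- By continuity the supremum may be taken over a countable dense set of parameters. -/
lemma aemeasurable_biSup_enorm {E : Type*} [TopologicalSpace E] [SecondCountableTopology E]
    {T : Set E} {g : S → E → F}
    (hc : ∀ᵐ x ∂μ, ContinuousOn (g x) T)
    (hm : ∀ θ ∈ T, AEStronglyMeasurable (fun x => g x θ) μ) :
    AEMeasurable (fun x => ⨆ θ ∈ T, ‖g x θ‖ₑ) μ := by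
  obtain ⟨D, hDT, hDc, hTD⟩ : ∃ D ⊆ T, D.Countable ∧ T ⊆ closure D := by
    obtain ⟨D, hD, hd⟩ := TopologicalSpace.exists_countable_dense T
    refine ⟨Subtype.val '' D, Subtype.coe_image_subset T D, hD.image _, fun x hx => ?_⟩
    have := hd ⟨x, hx⟩
    rwa [closure_subtype] at this
  have hD : AEMeasurable (fun x => ⨆ θ ∈ D, ‖g x θ‖ₑ) μ :=
    AEMeasurable.biSup D hDc fun θ hθ => (hm θ (hDT hθ)).enorm
  refine hD.congr ?_
  filter_upwards [hc] with x hx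
  refine le_antisymm (biSup_mono fun θ hθ => hDT hθ) (iSup₂_le fun θ hθ => ?_)
  have : (𝓝[D] θ).NeBot := mem_closure_iff_nhdsWithin_neBot.1 (hTD hθ)
  have ht : Tendsto (fun θ' => ‖g x θ'‖ₑ) (𝓝[D] θ) (𝓝 ‖g x θ‖ₑ) :=
    (((hx θ hθ).mono hDT).tendsto).enorm
  refine le_of_tendsto ht (eventually_mem_nhdsWithin.mono fun θ' hθ' => ?_)
  exact le_iSup₂ (f := fun θ (_ : θ ∈ D) => ‖g x θ‖ₑ) θ' hθ'

lemma exists_integrable_of_lintegral_biSup {E : Type*} [TopologicalSpace E]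
    [SecondCountableTopology E] {T : Set E} {g : S → E → F}
    (hc : ∀ᵐ x ∂μ, ContinuousOn (g x) T)
    (hm : ∀ θ ∈ T, AEStronglyMeasurable (fun x => g x θ) μ)
    (hfin : ∫⁻ x, ⨆ θ ∈ T, ‖g x θ‖ₑ ∂μ < ∞) :
    ∃ b : S → ℝ, Integrable b μ ∧ ∀ᵐ x ∂μ, ∀ θ ∈ T, ‖g x θ‖ ≤ b x := by
  have hmeas := aemeasurable_biSup_enorm hc hm
  refine ⟨_, integrable_toReal_of_lintegral_ne_top hmeas hfin.ne, ?_⟩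
  filter_upwards [ae_lt_top' hmeas hfin.ne] with x hx θ hθ
  rw [← toReal_enorm]
  exact ENNReal.toReal_mono hx.ne (le_iSup₂ (f := fun θ (_ : θ ∈ T) => ‖g x θ‖ₑ) θ hθ)

/-- A dominated family of continuous functions has a modulus of continuity at each point whose
mean is as small as desired. -/
lemma exists_integrable_modulus {E : Type*} [PseudoMetricSpace E] [SecondCountableTopology E]
    {T : Set E} {g : S → E → F}
    (hc : ∀ᵐ x ∂μ, ContinuousOn (g x) T)
    (hm : ∀ θ ∈ T, AEStronglyMeasurable (fun x => g x θ) μ)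
    {b : S → ℝ} (hb : Integrable b μ) (hgb : ∀ᵐ x ∂μ, ∀ θ ∈ T, ‖g x θ‖ ≤ b x)
    {θ₀ : E} (hθ₀ : θ₀ ∈ T) {γ : ℝ} (hγ : 0 < γ) :
    ∃ ρ > 0, ∃ w : S → ℝ, Integrable w μ ∧ ∫ x, w x ∂μ < γ ∧
      ∀ᵐ x ∂μ, ∀ θ ∈ T, dist θ θ₀ < ρ → ‖g x θ - g x θ₀‖ ≤ w x := by
  set W : ℕ → S → ℝ≥0∞ := fun n x =>
    ⨆ θ ∈ T ∩ Metric.ball θ₀ (1 / ((n : ℝ) + 1)), ‖g x θ - g x θ₀‖ₑ with hW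
  have hWm : ∀ n, AEMeasurable (W n) μ := fun n =>
    aemeasurable_biSup_enorm (g := fun x θ => g x θ - g x θ₀)
      (hc.mono fun x hx => (hx.mono Set.inter_subset_left).sub continuousOn_const)
      (fun θ hθ => (hm θ hθ.1).sub (hm θ₀ hθ₀))
  have hWb : ∀ n, W n ≤ᵐ[μ] fun x => ENNReal.ofReal (2 * b x) := fun n => by
    filter_upwards [hgb] with x hx
    refine iSup₂_le fun θ hθ => ?_
    rw [← ofReal_norm]
    refine ENNReal.ofReal_le_ofReal ((norm_sub_le _ _).trans ?_)
    linarith [hx θ hθ.1, hx θ₀ hθ₀]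
  have hfin : ∫⁻ x, ENNReal.ofReal (2 * b x) ∂μ ≠ ∞ := (hb.const_mul 2).lintegral_lt_top.ne
  have hlim : ∀ᵐ x ∂μ, Tendsto (fun n => W n x) atTop (𝓝 0) := by
    filter_upwards [hc] with x hx
    rw [ENNReal.tendsto_nhds_zero]
    intro ε hε
    have h0 : Tendsto (fun θ => ‖g x θ - g x θ₀‖ₑ) (𝓝[T] θ₀) (𝓝 0) := by
      have := ((hx θ₀ hθ₀).tendsto.sub_const (g x θ₀)).enorm
      simpa using this
    obtain ⟨ρ, hρ, hρT⟩ := Metric.mem_nhdsWithin_iff.1 (ENNReal.tendsto_nhds_zero.1 h0 ε hε)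
    have hev : ∀ᶠ n : ℕ in atTop, 1 / ((n : ℝ) + 1) < ρ :=
      tendsto_one_div_add_atTop_nhds_zero_nat.eventually_lt_const hρ
    filter_upwards [hev] with n hn
    exact iSup₂_le fun θ hθ => hρT ⟨Metric.ball_subset_ball hn.le hθ.2, hθ.1⟩
  have hint := tendsto_lintegral_of_dominated_convergence' _ hWm hWb hfin hlim
  rw [lintegral_zero] at hint
  obtain ⟨n, hn⟩ := (hint.eventually_lt_const (ENNReal.ofReal_pos.2 hγ)).exists
  have hn' : ∫⁻ x, W n x ∂μ ≠ ∞ := (hn.trans ENNReal.ofReal_lt_top).ne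
  refine ⟨1 / ((n : ℝ) + 1), by positivity, fun x => (W n x).toReal,
    integrable_toReal_of_lintegral_ne_top (hWm n) hn', ?_, ?_⟩
  · rw [integral_toReal (hWm n) (ae_lt_top' (hWm n) hn')]
    exact ENNReal.toReal_lt_of_lt_ofReal hn
  · filter_upwards [ae_lt_top' (hWm n) hn'] with x hx θ hθ hd
    rw [← toReal_enorm]
    exact ENNReal.toReal_mono hx.ne
      (le_iSup₂ (f := fun θ (_ : θ ∈ T ∩ Metric.ball θ₀ (1 / ((n : ℝ) + 1))) =>
        ‖g x θ - g x θ₀‖ₑ) θ ⟨hθ, hd⟩)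

end Envelope

/-! ### Consistency of approximate maximizers -/

section Consistency

variable {Ω : Type*} [MeasurableSpace Ω] {P : Measure Ω} [IsProbabilityMeasure P]
  {S : Type*} [MeasurableSpace S] {μ : Measure S} {z : ℕ → Ω → S}

/-- Wald's consistency argument: if the mean criterion `θ ↦ ∫ l x θ ∂μ` has a unique maximizer
`θ₀` on the compact set `T`, then asymptotic maximizers of the empirical criterion converge to `θ₀`
in probability. -/
lemma withHighProb_dist_lt_of_approx_max {E : Type*} [PseudoMetricSpace E]
    [SecondCountableTopology E]
    (hz_law : ∀ i, HasLaw (z i) μ P) (hz_indep : iIndepFun z P)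
    {T : Set E} (hT : IsCompact T) {l : S → E → ℝ}
    (hc : ∀ᵐ x ∂μ, ContinuousOn (l x) T)
    (hm : ∀ θ ∈ T, AEStronglyMeasurable (fun x => l x θ) μ)
    {b : S → ℝ} (hb : Integrable b μ) (hlb : ∀ᵐ x ∂μ, ∀ θ ∈ T, ‖l x θ‖ ≤ b x)
    {θ₀ : E} (hθ₀ : θ₀ ∈ T)
    (hmax : ∀ θ ∈ T, 0 < dist θ θ₀ → ∫ x, l x θ ∂μ < ∫ x, l x θ₀ ∂μ)
    {θhat : ℕ → Ω → E} (hmem : WithHighProb P (fun n ω => θhat n ω ∈ T))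
    (hopt : ∀ ε > 0, WithHighProb P (fun n ω =>
      (n : ℝ)⁻¹ * ∑ i ∈ Finset.range n, l (z i ω) θ₀ - ε
        ≤ (n : ℝ)⁻¹ * ∑ i ∈ Finset.range n, l (z i ω) (θhat n ω)))
    {ε : ℝ} (hε : 0 < ε) : WithHighProb P (fun n ω => dist (θhat n ω) θ₀ < ε) := by
  have hint : ∀ θ ∈ T, Integrable (fun x => l x θ) μ := fun θ hθ =>
    hb.mono' (hm θ hθ) (hlb.mono fun x hx => hx θ hθ)
  have hK : IsCompact (T \ Metric.ball θ₀ ε) := hT.diff Metric.isOpen_ball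
  -- Near every `θ ≠ θ₀` there are, with high probability, no asymptotic maximizers.
  have hloc : ∀ θ ∈ T \ Metric.ball θ₀ ε, ∃ ρ > 0,
      WithHighProb P (fun n ω => θhat n ω ∉ Metric.ball θ ρ) := by
    rintro θ ⟨hθT, hθε⟩
    have hpos : 0 < dist θ θ₀ := hε.trans_le (not_lt.1 hθε)
    set gap : ℝ := ∫ x, l x θ₀ ∂μ - ∫ x, l x θ ∂μ with hgap
    have hgap0 : 0 < gap := sub_pos.2 (hmax θ hθT hpos)
    obtain ⟨ρ, hρ, w, hw, hwint, hwl⟩ := exists_integrable_modulus hc hm hb hlb hθT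
      (γ := gap / 4) (by positivity)
    refine ⟨ρ, hρ, ?_⟩
    have h1 := withHighProb_average_lt hz_law hz_indep ((hint θ hθT).add hw)
      (c := ∫ x, l x θ₀ ∂μ - gap / 2) (by
        simp only [Pi.add_apply]
        rw [integral_add (hint θ hθT) hw]; linarith)
    have h2 := withHighProb_average_lt hz_law hz_indep (hint θ₀ hθ₀).neg
      (c := -(∫ x, l x θ₀ ∂μ) + gap / 8) (by
        simp only [Pi.neg_apply]
        rw [integral_neg]; linarith)
    have h3 := hopt (gap / 8) (by positivity)
    have h4 := ae_forall_sample hz_law hwl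
    refine (((h1.and h2).and h3).and hmem).mono (.of_forall fun n => ?_)
    filter_upwards [h4] with ω hω ⟨⟨⟨h1, h2⟩, h3⟩, hT⟩ hball
    have hle : (n : ℝ)⁻¹ * ∑ i ∈ Finset.range n, l (z i ω) (θhat n ω)
        ≤ (n : ℝ)⁻¹ * ∑ i ∈ Finset.range n, ((fun x => l x θ) + w) (z i ω) := by
      gcongr with i _
      have := (le_abs_self _).trans (hω i (θhat n ω) hT hball)
      simp only [Pi.add_apply]
      linarith
    simp only [Pi.neg_apply, Finset.sum_neg_distrib, mul_neg] at h2
    linarith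
  choose! ρ hρ hρP using hloc
  obtain ⟨t, htK, htcov⟩ := hK.elim_nhds_subcover (fun θ => Metric.ball θ (ρ θ))
    fun θ hθ => Metric.ball_mem_nhds θ (hρ θ hθ)
  refine (hmem.and (WithHighProb.finset_forall t fun θ hθ => hρP θ (htK θ hθ))).mono
    (.of_forall fun n => .of_forall ?_)
  rintro ω ⟨hωT, hω⟩
  by_contra hnot
  obtain ⟨θ, hθt, hθ⟩ := Set.mem_iUnion₂.1 (htcov ⟨hωT, hnot⟩)
  exact hω θ hθt hθ

end Consistency

/-! ### Linearization of the estimating equation -/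

section Linearization

variable {Ω : Type*} [MeasurableSpace Ω] {P : Measure Ω} [IsProbabilityMeasure P]
  {S : Type*} [MeasurableSpace S] {μ : Measure S} {z : ℕ → Ω → S}
  {E : Type*} [NormedAddCommGroup E] [NormedSpace ℝ E] [FiniteDimensional ℝ E]

/-- The empirical mean of a random field `s` is, near `θ₀` and with high probability, as close to
its linearization with the mean derivative `∫ D x θ₀ ∂μ` as desired. -/
lemma exists_withHighProb_average_linearization
    (hz_law : ∀ i, HasLaw (z i) μ P) (hz_indep : iIndepFun z P)
    {N : Set E} (hN : IsOpen N) {θ₀ : E} (hθ₀ : θ₀ ∈ N) {s : S → E → E} {D : S → E → E →L[ℝ] E}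
    (hD : ∀ᵐ x ∂μ, ∀ θ ∈ N, HasFDerivAt (s x) (D x θ) θ)
    (hDc : ∀ᵐ x ∂μ, ContinuousOn (D x) N)
    (hDm : ∀ θ ∈ N, AEStronglyMeasurable (fun x => D x θ) μ)
    {b : S → ℝ} (hb : Integrable b μ) (hDb : ∀ᵐ x ∂μ, ∀ θ ∈ N, ‖D x θ‖ ≤ b x)
    {γ : ℝ} (hγ : 0 < γ) :
    ∃ ρ > 0, WithHighProb P (fun n ω => ∀ θ, dist θ θ₀ < ρ →
      ‖(n : ℝ)⁻¹ • ∑ i ∈ Finset.range n, s (z i ω) θ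
        - (n : ℝ)⁻¹ • ∑ i ∈ Finset.range n, s (z i ω) θ₀
        - (∫ x, D x θ₀ ∂μ) (θ - θ₀)‖ ≤ γ * ‖θ - θ₀‖) := by
  have : ProperSpace E := FiniteDimensional.proper_real E
  obtain ⟨ρ₁, hρ₁, w, hw, hwint, hwD⟩ := exists_integrable_modulus hDc hDm hb hDb hθ₀
    (half_pos hγ)
  obtain ⟨ρ₂, hρ₂, hρN⟩ := Metric.isOpen_iff.1 hN θ₀ hθ₀
  have hD₀ : Integrable (fun x => D x θ₀) μ :=
    hb.mono' (hDm θ₀ hθ₀) (hDb.mono fun x hx => hx θ₀ hθ₀)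
  set A := ∫ x, D x θ₀ ∂μ with hA
  have h1 := withHighProb_average_lt hz_law hz_indep hw hwint
  have h2' := tendstoInMeasure_average hz_law hz_indep hD₀
  have h2 := withHighProb_norm_sub_lt h2' (half_pos hγ)
  refine ⟨min ρ₁ ρ₂, lt_min hρ₁ hρ₂, (h1.and h2).mono (.of_forall fun n => ?_)⟩
  filter_upwards [ae_forall_sample hz_law (hwD.and hD)] with ω hω ⟨h1, h2⟩ θ hθ
  have hpt : ∀ i, ‖s (z i ω) θ - s (z i ω) θ₀ - D (z i ω) θ₀ (θ - θ₀)‖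
      ≤ w (z i ω) * ‖θ - θ₀‖ := by
    intro i
    refine (convex_ball θ₀ (min ρ₁ ρ₂)).norm_image_sub_le_of_norm_hasFDerivWithin_le'
      (f' := D (z i ω)) (fun y hy => ?_) (fun y hy => ?_)
      (Metric.mem_ball_self (lt_min hρ₁ hρ₂)) hθ
    · exact ((hω i).2 y (hρN (Metric.ball_subset_ball (min_le_right _ _) hy))).hasFDerivWithinAt
    · exact (hω i).1 y (hρN (Metric.ball_subset_ball (min_le_right _ _) hy))
        (lt_of_lt_of_le hy (min_le_left _ _))
  have hsplit : (n : ℝ)⁻¹ • ∑ i ∈ Finset.range n, s (z i ω) θ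
        - (n : ℝ)⁻¹ • ∑ i ∈ Finset.range n, s (z i ω) θ₀ - A (θ - θ₀)
      = (n : ℝ)⁻¹ • ∑ i ∈ Finset.range n,
          (s (z i ω) θ - s (z i ω) θ₀ - D (z i ω) θ₀ (θ - θ₀))
        + ((n : ℝ)⁻¹ • ∑ i ∈ Finset.range n, D (z i ω) θ₀ - A) (θ - θ₀) := by
    simp only [Finset.sum_sub_distrib, smul_sub, sub_apply,
      smul_apply, sum_apply]
    abel
  rw [hsplit]
  have hfst : ‖(n : ℝ)⁻¹ • ∑ i ∈ Finset.range n,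
      (s (z i ω) θ - s (z i ω) θ₀ - D (z i ω) θ₀ (θ - θ₀))‖ ≤ γ / 2 * ‖θ - θ₀‖ := by
    rw [norm_smul, Real.norm_of_nonneg (by positivity)]
    calc _ ≤ (n : ℝ)⁻¹ * ∑ i ∈ Finset.range n, w (z i ω) * ‖θ - θ₀‖ := by
          gcongr
          exact (norm_sum_le _ _).trans (Finset.sum_le_sum fun i _ => hpt i)
      _ = ((n : ℝ)⁻¹ * ∑ i ∈ Finset.range n, w (z i ω)) * ‖θ - θ₀‖ := by
          rw [← Finset.sum_mul, mul_assoc]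
      _ ≤ _ := by gcongr
  have hsnd : ‖((n : ℝ)⁻¹ • ∑ i ∈ Finset.range n, D (z i ω) θ₀ - A) (θ - θ₀)‖
      ≤ γ / 2 * ‖θ - θ₀‖ :=
    (ContinuousLinearMap.le_opNorm _ _).trans (by gcongr)
  calc _ ≤ _ := norm_add_le _ _
    _ ≤ γ / 2 * ‖θ - θ₀‖ + γ / 2 * ‖θ - θ₀‖ := add_le_add hfst hsnd
    _ = γ * ‖θ - θ₀‖ := by ring

/-- The asymptotic expansion of an approximate root `θhat` of the estimating equation
`∑ i < n, s (z i) θ = 0`.  Here `J` is minus the inverse of the mean derivative of `s` at `θ₀`. -/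
lemma withHighProb_norm_sqrt_smul_sub_lt
    (hz_law : ∀ i, HasLaw (z i) μ P) (hz_indep : iIndepFun z P)
    {N : Set E} (hN : IsOpen N) {θ₀ : E} (hθ₀ : θ₀ ∈ N) {s : S → E → E} {D : S → E → E →L[ℝ] E}
    (hD : ∀ᵐ x ∂μ, ∀ θ ∈ N, HasFDerivAt (s x) (D x θ) θ)
    (hDc : ∀ᵐ x ∂μ, ContinuousOn (D x) N)
    (hDm : ∀ θ ∈ N, AEStronglyMeasurable (fun x => D x θ) μ)
    {b : S → ℝ} (hb : Integrable b μ) (hDb : ∀ᵐ x ∂μ, ∀ θ ∈ N, ‖D x θ‖ ≤ b x)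
    {J : E →L[ℝ] E} (hJ : ∀ v, J ((∫ x, D x θ₀ ∂μ) v) = -v)
    {θhat : ℕ → Ω → E} (hcons : ∀ ε > 0, WithHighProb P (fun n ω => dist (θhat n ω) θ₀ < ε))
    (hroot : ∀ ε > 0, WithHighProb P (fun n ω =>
      √(n : ℝ) * ‖(n : ℝ)⁻¹ • ∑ i ∈ Finset.range n, s (z i ω) (θhat n ω)‖ < ε))
    (htight : ∀ τ : ℝ≥0∞, 0 < τ → ∃ K : ℝ, ∀ᶠ n : ℕ in atTop,
      P {ω | K ≤ ‖(√(n : ℝ))⁻¹ • ∑ i ∈ Finset.range n, J (s (z i ω) θ₀)‖} ≤ τ)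
    {η : ℝ} (hη : 0 < η) :
    WithHighProb P (fun n ω => ‖√(n : ℝ) • (θhat n ω - θ₀)
      - (√(n : ℝ))⁻¹ • ∑ i ∈ Finset.range n, J (s (z i ω) θ₀)‖ < η) := by
  rw [WithHighProb, ENNReal.tendsto_nhds_zero]
  intro τ hτ
  obtain ⟨K, hK⟩ := htight (τ / 2) (ENNReal.half_pos hτ.ne')
  set κ := ‖J‖ with hκ
  have hκ0 : 0 ≤ κ := norm_nonneg _
  set g : ℝ := min (1 / 2) (η / (8 * (|K| + 1))) with hg
  have hK1 : 0 < |K| + 1 := by positivity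
  have hg0 : 0 < g := by positivity
  have hg1 : g ≤ 1 / 2 := min_le_left _ _
  have hg2 : g * (|K| + 1) ≤ η / 8 := by
    calc g * (|K| + 1) ≤ η / (8 * (|K| + 1)) * (|K| + 1) := by gcongr; exact min_le_right _ _
      _ = η / 8 := by field_simp
  obtain ⟨ρ, hρ, hlin⟩ := exists_withHighProb_average_linearization hz_law hz_indep hN hθ₀ hD hDc
    hDm hb hDb (γ := g / (κ + 1)) (by positivity)
  have hgood := (hlin.and (hcons ρ hρ)).and (hroot (η / (8 * (κ + 1))) (by positivity))
  rw [WithHighProb, ENNReal.tendsto_nhds_zero] at hgood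
  filter_upwards [hK, hgood (τ / 2) (ENNReal.half_pos hτ.ne')] with n hKn hgn
  refine le_trans (measure_mono ?_) ((measure_union_le _ _).trans
    ((add_le_add hKn hgn).trans_eq (ENNReal.add_halves τ)))
  intro ω hω
  by_contra hnot
  rw [Set.mem_union, not_or] at hnot
  obtain ⟨hX, hgood⟩ := hnot
  simp only [Set.mem_ofPred_eq, not_not, not_le] at hX hgood
  obtain ⟨⟨hlin, hd⟩, hroot⟩ := hgood
  apply hω
  have hlin := hlin _ hd
  set u := θhat n ω - θ₀ with hu
  set X := (√(n : ℝ))⁻¹ • ∑ i ∈ Finset.range n, J (s (z i ω) θ₀) with hXdef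
  set a := (n : ℝ)⁻¹ • ∑ i ∈ Finset.range n, s (z i ω) (θhat n ω) with ha
  set a₀ := (n : ℝ)⁻¹ • ∑ i ∈ Finset.range n, s (z i ω) θ₀ with ha₀
  have hXa : X = √(n : ℝ) • J a₀ := by
    rw [hXdef, ha₀, map_smul, map_sum, smul_smul]
    congr 1
    rw [← div_eq_mul_inv, Real.sqrt_div_self]
  -- Apply `J` to the linearized equation and multiply by `√n`.
  have key : √(n : ℝ) • u - X = √(n : ℝ) • J (a - a₀ - (∫ x, D x θ₀ ∂μ) u)
      - √(n : ℝ) • J a := by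
    rw [hXa, map_sub, map_sub, hJ, ← smul_sub, ← smul_sub]
    congr 1
    abel
  have hn0 : 0 ≤ √(n : ℝ) := Real.sqrt_nonneg _
  have h1 : ‖√(n : ℝ) • J a‖ ≤ η / 8 := by
    rw [norm_smul, Real.norm_of_nonneg hn0]
    calc √(n : ℝ) * ‖J a‖ ≤ √(n : ℝ) * (κ * ‖a‖) := by gcongr; exact J.le_opNorm a
      _ = κ * (√(n : ℝ) * ‖a‖) := by ring
      _ ≤ κ * (η / (8 * (κ + 1))) := by gcongr
      _ ≤ (κ + 1) * (η / (8 * (κ + 1))) := by gcongr; linarith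
      _ = η / 8 := by field_simp
  have h2 : ‖√(n : ℝ) • J (a - a₀ - (∫ x, D x θ₀ ∂μ) u)‖ ≤ g * ‖√(n : ℝ) • u‖ := by
    rw [norm_smul, norm_smul, Real.norm_of_nonneg hn0]
    calc √(n : ℝ) * ‖J (a - a₀ - (∫ x, D x θ₀ ∂μ) u)‖
        ≤ √(n : ℝ) * (κ * (g / (κ + 1) * ‖u‖)) := by
          gcongr
          exact (J.le_opNorm _).trans (by gcongr)
      _ ≤ √(n : ℝ) * ((κ + 1) * (g / (κ + 1) * ‖u‖)) := by gcongr; linarith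
      _ = g * (√(n : ℝ) * ‖u‖) := by field_simp
  have h3 : ‖√(n : ℝ) • u - X‖ ≤ η / 8 + g * ‖√(n : ℝ) • u‖ := by
    rw [key]; exact (norm_sub_le _ _).trans ((add_le_add h2 h1).trans_eq (add_comm _ _))
  have h4 : ‖√(n : ℝ) • u‖ ≤ ‖√(n : ℝ) • u - X‖ + ‖X‖ := by
    simpa using norm_add_le (√(n : ℝ) • u - X) X
  have h5 : ‖X‖ ≤ |K| + 1 := by linarith [le_abs_self K]
  nlinarith [mul_le_mul_of_nonneg_left h4 hg0.le, mul_le_mul_of_nonneg_left h5 hg0.le,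
    mul_le_mul_of_nonneg_right hg1 (norm_nonneg (√(n : ℝ) • u - X))]

end Linearization

/-! ### The multivariate central limit theorem -/

section CLT

variable {Ω : Type*} [MeasurableSpace Ω] {P : Measure Ω} [IsProbabilityMeasure P]

/-- Convergence in distribution implies tightness. -/
lemma exists_eventually_measure_le_of_tendstoInDistribution {E : Type*} [NormedAddCommGroup E]
    [MeasurableSpace E] [BorelSpace E] {X : ℕ → Ω → E} {Ω' : Type*} [MeasurableSpace Ω']
    {P' : Measure Ω'} [IsProbabilityMeasure P'] {Y : Ω' → E}
    (h : TendstoInDistribution X atTop Y (fun _ => P) P') {τ : ℝ≥0∞} (hτ : 0 < τ) :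
    ∃ K : ℝ, ∀ᶠ n in atTop, P {ω | K ≤ ‖X n ω‖} ≤ τ := by
  have hprob : IsProbabilityMeasure (P'.map Y) :=
    Measure.isProbabilityMeasure_map h.aemeasurable_limit
  have hclosed : ∀ k : ℕ, IsClosed {x : E | (k : ℝ) ≤ ‖x‖} := fun k =>
    isClosed_le continuous_const continuous_norm
  have hlim : Tendsto (fun k : ℕ => (P'.map Y) {x : E | (k : ℝ) ≤ ‖x‖}) atTop (𝓝 0) := by
    have hempty : ⋂ k : ℕ, {x : E | (k : ℝ) ≤ ‖x‖} = ∅ := by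
      ext x
      simp only [Set.mem_iInter, Set.mem_ofPred_eq, Set.mem_empty_iff_false, iff_false, not_forall,
        not_le]
      exact exists_nat_gt ‖x‖
    have := tendsto_measure_iInter_atTop (μ := P'.map Y)
      (s := fun k : ℕ => {x : E | (k : ℝ) ≤ ‖x‖})
      (fun k => (hclosed k).measurableSet.nullMeasurableSet)
      (fun i j hij x (hx : (j : ℝ) ≤ ‖x‖) => (Nat.cast_le.2 hij).trans hx) ⟨0, measure_ne_top _ _⟩
    rwa [hempty, measure_empty] at this
  obtain ⟨k, hk⟩ := (hlim.eventually_lt_const hτ).exists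
  refine ⟨k, ?_⟩
  have hls := ProbabilityMeasure.limsup_measure_closed_le_of_tendsto h.tendsto (hclosed k)
  filter_upwards [eventually_lt_of_limsup_lt (hls.trans_lt hk)] with n hn
  refine le_of_eq_of_le ?_ hn.le
  exact (Measure.map_apply_of_aemeasurable (h.forall_aemeasurable n)
    (hclosed k).measurableSet).symm

/-- The central limit theorem in `ℝ^p`, by the Cramér–Wold device. -/
lemma tendstoInDistribution_inv_sqrt_smul_sum {p : ℕ} {X : ℕ → Ω → EuclideanSpace ℝ (Fin p)}
    (hindep : iIndepFun X P) (hident : ∀ i, IdentDistrib (X i) (X 0) P P)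
    (hL2 : MemLp (X 0) 2 P) (hmean : ∫ ω, X 0 ω ∂P = 0)
    {V : Matrix (Fin p) (Fin p) ℝ} (hV : V.PosSemidef)
    (hcov : ∀ t : EuclideanSpace ℝ (Fin p), ∫ ω, (inner ℝ (X 0 ω) t) ^ 2 ∂P = t ⬝ᵥ V.mulVec t) :
    TendstoInDistribution (fun (n : ℕ) ω => (√(n : ℝ))⁻¹ • ∑ k ∈ Finset.range n, X k ω) atTop id
      (fun _ => P) (multivariateGaussian 0 V) where
  forall_aemeasurable n := by
    have := fun i => (hident i).aemeasurable_fst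
    fun_prop
  aemeasurable_limit := aemeasurable_id
  tendsto := by
    refine ProbabilityMeasure.tendsto_iff_tendsto_charFun.2 fun t => ?_
    have hmt : Measurable fun x : EuclideanSpace ℝ (Fin p) => inner ℝ x t := by fun_prop
    have hL2t : MemLp (fun ω => inner ℝ (X 0 ω) t) 2 P := hL2.inner_const (𝕜 := ℝ) t
    have hmeant : ∫ ω, inner ℝ (X 0 ω) t ∂P = 0 := by
      have h1 : Integrable (X 0) P := hL2.integrable one_le_two
      simp_rw [real_inner_comm]
      rw [integral_inner h1 t, hmean, inner_zero_right]
    have hvar : Var[fun ω => inner ℝ (X 0 ω) t; P] = t ⬝ᵥ V.mulVec t := by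
      rw [variance_of_integral_eq_zero hL2t.aestronglyMeasurable.aemeasurable hmeant, hcov]
    have hnonneg : 0 ≤ t ⬝ᵥ V.mulVec t := hvar ▸ variance_nonneg _ _
    have hclt := tendstoInDistribution_inv_sqrt_mul_sum_sub
      (P := P) (P' := gaussianReal 0 (Var[fun ω => inner ℝ (X 0 ω) t; P]).toNNReal) (Y := id)
      (X := fun i ω => inner ℝ (X i ω) t) HasLaw.id hL2t
      (hindep.comp (fun _ x => inner ℝ x t) fun _ => hmt) (fun i => (hident i).comp hmt)
    have h1 := ProbabilityMeasure.tendsto_iff_tendsto_charFun.1 hclt.tendsto 1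
    simp only [ProbabilityMeasure.coe_mk, Measure.map_id, hmeant, mul_zero, sub_zero] at h1 ⊢
    rw [charFun_gaussianReal, hvar] at h1
    rw [charFun_multivariateGaussian hV]
    convert h1 using 2
    · rename_i n
      rw [charFun_apply, charFun_apply, integral_map, integral_map]
      · simp [inner_smul_left, sum_inner]
      · exact hclt.forall_aemeasurable n |>.congr (by simp [hmeant])
      · fun_prop
      · have := fun i => (hident i).aemeasurable_fst
        fun_prop
      · fun_prop
    · simp [Real.coe_toNNReal _ hnonneg]

end CLT

/-! ### Gradients and Hessians -/

section Calculus

variable {p : ℕ}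

/-- The Riesz isomorphism of `ℝ^p` in coordinates, as an honestly linear (not conjugate-linear)
map from the dual space. -/
noncomputable def rieszVector (p : ℕ) : (EuclideanSpace ℝ (Fin p) →L[ℝ] ℝ) →L[ℝ] EuclideanSpace ℝ (Fin p) :=
  ∑ i, (ContinuousLinearMap.apply ℝ ℝ (EuclideanSpace.basisFun (Fin p) ℝ i)).smulRight
    (EuclideanSpace.basisFun (Fin p) ℝ i)

lemma rieszVector_fderiv (g : EuclideanSpace ℝ (Fin p) → ℝ) (θ : EuclideanSpace ℝ (Fin p)) :
    rieszVector p (fderiv ℝ g θ) = gradient g θ := by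
  rw [← (EuclideanSpace.basisFun (Fin p) ℝ).sum_repr' (gradient g θ), rieszVector]
  simp only [sum_apply, ContinuousLinearMap.smulRight_apply, ContinuousLinearMap.apply_apply,
    real_inner_comm, inner_gradient_left]

lemma gradient_eq_comp (g : EuclideanSpace ℝ (Fin p) → ℝ) :
    gradient g = rieszVector p ∘ fderiv ℝ g :=
  funext fun θ => (rieszVector_fderiv g θ).symm

variable {g : EuclideanSpace ℝ (Fin p) → ℝ} {N : Set (EuclideanSpace ℝ (Fin p))}

lemma contDiffOn_gradient (hN : IsOpen N) (hg : ContDiffOn ℝ 2 g N) :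
    ContDiffOn ℝ 1 (gradient g) N := by
  rw [gradient_eq_comp]
  exact (rieszVector p).contDiff.comp_contDiffOn
    (hg.fderiv_of_isOpen hN (by norm_num [one_add_one_eq_two]))

lemma hasFDerivAt_gradient (hN : IsOpen N) (hg : ContDiffOn ℝ 2 g N) {θ : EuclideanSpace ℝ (Fin p)}
    (hθ : θ ∈ N) : HasFDerivAt (gradient g) (hessian g θ) θ :=
  (((contDiffOn_gradient hN hg).contDiffAt (hN.mem_nhds hθ)).differentiableAt
    one_ne_zero).hasFDerivAt

lemma continuousOn_hessian (hN : IsOpen N) (hg : ContDiffOn ℝ 2 g N) :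
    ContinuousOn (hessian g) N :=
  ((contDiffOn_gradient hN hg).fderiv_of_isOpen hN (m := 0) (by norm_num)).continuousOn

lemma gradient_log {θ : EuclideanSpace ℝ (Fin p)} (hd : DifferentiableAt ℝ g θ) (h0 : g θ ≠ 0) :
    gradient (fun θ => Real.log (g θ)) θ = (g θ)⁻¹ • gradient g θ := by
  rw [← rieszVector_fderiv, ← rieszVector_fderiv, fderiv.log hd h0, map_smul]

/-- The identity `g ∇² log g = ∇² g - g (∇ log g)(∇ log g)ᵀ`. -/
lemma smul_hessian_log (hN : IsOpen N) (hg : ContDiffOn ℝ 2 g N) (h0 : ∀ θ ∈ N, 0 < g θ)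
    {θ : EuclideanSpace ℝ (Fin p)} (hθ : θ ∈ N) :
    g θ • hessian (fun θ => Real.log (g θ)) θ = hessian g θ
      - g θ • (innerSL ℝ (gradient (fun θ => Real.log (g θ)) θ)).smulRight
          (gradient (fun θ => Real.log (g θ)) θ) := by
  have hd : ∀ θ ∈ N, DifferentiableAt ℝ g θ := fun θ hθ =>
    (hg.contDiffAt (hN.mem_nhds hθ)).differentiableAt two_ne_zero
  have hpos := h0 θ hθ
  have heq : gradient (fun θ => Real.log (g θ)) =ᶠ[𝓝 θ] fun θ => (g θ)⁻¹ • gradient g θ := by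
    filter_upwards [hN.mem_nhds hθ] with θ' hθ'
    exact gradient_log (hd θ' hθ') (h0 θ' hθ').ne'
  have hderiv := ((hasDerivAt_inv hpos.ne').comp_hasFDerivAt θ (hd θ hθ).hasFDerivAt).smul
    (hasFDerivAt_gradient hN hg hθ)
  have hH : hessian (fun θ => Real.log (g θ)) θ = _ := heq.fderiv_eq.trans hderiv.fderiv
  rw [hH, gradient_log (hd θ hθ) hpos.ne']
  ext1 v
  simp only [smul_apply, add_apply, sub_apply, ContinuousLinearMap.smulRight_apply,
    innerSL_apply_apply, inner_smul_left, inner_gradient_left, smul_add, smul_smul,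
    Function.comp_apply, conj_trivial, smul_eq_mul]
  rw [mul_inv_cancel₀ hpos.ne', one_smul, sub_eq_add_neg, ← neg_smul]
  congr 2
  field_simp

end Calculus

/-! ### Differentiation under the integral sign -/

section Parametric

variable {p : ℕ} {S : Type*} [MeasurableSpace S] {μ : Measure S}
  {F : Type*} [NormedAddCommGroup F] [NormedSpace ℝ F]
  {N : Set (EuclideanSpace ℝ (Fin p))}

/-- Derivatives of a measurable family of functions are limits of difference quotients, hence
measurable. -/
lemma aestronglyMeasurable_hasFDerivAt (hN : IsOpen N) {g : S → EuclideanSpace ℝ (Fin p) → F}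
    {D : S → EuclideanSpace ℝ (Fin p) →L[ℝ] F}
    (hm : ∀ θ ∈ N, AEStronglyMeasurable (fun x => g x θ) μ)
    {θ : EuclideanSpace ℝ (Fin p)} (hθ : θ ∈ N) (hD : ∀ᵐ x ∂μ, HasFDerivAt (g x) (D x) θ) :
    AEStronglyMeasurable D μ := by
  have hv : ∀ v, AEStronglyMeasurable (fun x => D x v) μ := by
    intro v
    have hto : Tendsto (fun n : ℕ => θ + (n : ℝ)⁻¹ • v) atTop (𝓝 θ) := by
      have h := (tendsto_inv_atTop_nhds_zero_nat (𝕜 := ℝ)).smul_const v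
      simpa using h.const_add θ
    obtain ⟨n₀, hn₀⟩ := eventually_atTop.1 (hto.eventually (hN.mem_nhds hθ))
    refine aestronglyMeasurable_of_tendsto_ae atTop
      (f := fun n x => ((n + n₀ : ℕ) : ℝ) • (g x (θ + ((n + n₀ : ℕ) : ℝ)⁻¹ • v) - g x θ))
      (fun n => ((hm _ (hn₀ _ (Nat.le_add_left _ _))).sub (hm θ hθ)).const_smul _) ?_
    filter_upwards [hD] with x hx
    refine hx.lim v (c := fun n : ℕ => ((n + n₀ : ℕ) : ℝ)) ?_
    simp only [Real.norm_natCast]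
    exact tendsto_natCast_atTop_atTop.comp (tendsto_add_atTop_nat n₀)
  have hsum : D = fun x => ∑ i, ContinuousLinearMap.smulRightL ℝ _ F
      (innerSL ℝ (EuclideanSpace.basisFun (Fin p) ℝ i))
      (D x (EuclideanSpace.basisFun (Fin p) ℝ i)) := by
    funext x
    ext1 v
    conv_lhs => rw [← (EuclideanSpace.basisFun (Fin p) ℝ).sum_repr' v]
    simp [map_sum, sum_apply]
  rw [hsum]
  exact Finset.aestronglyMeasurable_fun_sum _ fun i _ =>
    (ContinuousLinearMap.continuous _).comp_aestronglyMeasurable (hv _)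

/-- If `∫ g x θ ∂μ` does not depend on `θ ∈ N`, its derivative, computed under the integral sign,
vanishes. -/
lemma integral_hasFDerivAt_eq_zero (hN : IsOpen N)
    {g : S → EuclideanSpace ℝ (Fin p) → F}
    {D : S → EuclideanSpace ℝ (Fin p) → EuclideanSpace ℝ (Fin p) →L[ℝ] F}
    (hint : ∀ θ ∈ N, Integrable (fun x => g x θ) μ)
    (hD : ∀ᵐ x ∂μ, ∀ θ ∈ N, HasFDerivAt (g x) (D x θ) θ)
    {b : S → ℝ} (hb : Integrable b μ) (hDb : ∀ᵐ x ∂μ, ∀ θ ∈ N, ‖D x θ‖ ≤ b x)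
    {c : F} (hconst : ∀ θ ∈ N, ∫ x, g x θ ∂μ = c)
    {θ : EuclideanSpace ℝ (Fin p)} (hθ : θ ∈ N) : ∫ x, D x θ ∂μ = 0 := by
  have hNθ := hN.mem_nhds hθ
  have hderiv := hasFDerivAt_integral_of_dominated_of_fderiv_le (𝕜 := ℝ)
    (F := fun θ x => g x θ) (F' := fun θ x => D x θ) hNθ
    (by filter_upwards [hNθ] with θ' hθ' using (hint θ' hθ').aestronglyMeasurable)
    (hint θ hθ)
    (aestronglyMeasurable_hasFDerivAt hN (fun θ hθ => (hint θ hθ).aestronglyMeasurable) hθ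
      (hD.mono fun x hx => hx θ hθ)) hDb hb hD
  refine hderiv.unique ((hasFDerivAt_const c θ).congr_of_eventuallyEq ?_)
  filter_upwards [hNθ] with θ' hθ' using hconst θ' hθ'

end Parametric

/-! ### Second moments of random vectors -/

section SecondMoments

variable {p : ℕ} {S : Type*} [MeasurableSpace S] {μ : Measure S}
  {s : S → EuclideanSpace ℝ (Fin p)}

lemma memLp_two_of_integrable_mul (hs : AEStronglyMeasurable s μ)
    (h : ∀ i, Integrable (fun x => s x i * s x i) μ) : MemLp s 2 μ := by
  rw [memLp_two_iff_integrable_sq_norm hs]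
  simp only [EuclideanSpace.norm_sq_eq]
  refine integrable_finsetSum _ fun i _ => ?_
  simpa [pow_two] using h i

lemma integral_inner_mul_apply (h : ∀ i j, Integrable (fun x => s x i * s x j) μ)
    (v : EuclideanSpace ℝ (Fin p)) (i : Fin p) :
    ∫ x, inner ℝ (s x) v * s x i ∂μ
      = (Matrix.of fun i j => ∫ x, s x i * s x j ∂μ).mulVec v i := by
  simp only [PiLp.inner_apply, RCLike.inner_apply, conj_trivial, Finset.sum_mul, Matrix.mulVec,
    dotProduct, Matrix.of_apply]
  rw [integral_finsetSum]
  · refine Finset.sum_congr rfl fun j _ => ?_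
    rw [← integral_mul_const]
    congr 1 with x
    ring
  · intro j _
    refine ((h i j).const_mul (v j)).congr (.of_forall fun x => ?_)
    ring

lemma integrable_inner_mul_apply (h : ∀ i j, Integrable (fun x => s x i * s x j) μ)
    (v : EuclideanSpace ℝ (Fin p)) (i : Fin p) :
    Integrable (fun x => inner ℝ (s x) v * s x i) μ := by
  simp only [PiLp.inner_apply, RCLike.inner_apply, conj_trivial, Finset.sum_mul]
  refine integrable_finsetSum _ fun j _ => ((h i j).const_mul (v j)).congr (.of_forall fun x => ?_)
  ring

lemma integral_inner_sq (h : ∀ i j, Integrable (fun x => s x i * s x j) μ)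
    (v : EuclideanSpace ℝ (Fin p)) :
    ∫ x, inner ℝ (s x) v ^ 2 ∂μ
      = v ⬝ᵥ (Matrix.of fun i j => ∫ x, s x i * s x j ∂μ).mulVec v := by
  have hexp : ∀ x, inner ℝ (s x) v ^ 2 = ∑ i, v i * (inner ℝ (s x) v * s x i) := by
    intro x
    rw [pow_two]
    nth_rewrite 2 [PiLp.inner_apply]
    simp only [RCLike.inner_apply, conj_trivial, Finset.mul_sum]
    exact Finset.sum_congr rfl fun i _ => by ring
  simp only [hexp]
  rw [integral_finsetSum _ fun i _ => (integrable_inner_mul_apply h v i).const_mul _]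
  simp only [integral_const_mul, integral_inner_mul_apply h, dotProduct]

lemma posSemidef_integral_mul (h : ∀ i j, Integrable (fun x => s x i * s x j) μ) :
    (Matrix.of fun i j => ∫ x, s x i * s x j ∂μ).PosSemidef := by
  refine Matrix.PosSemidef.of_dotProduct_mulVec_nonneg ?_ fun v => ?_
  · ext i j
    simp [Matrix.conjTranspose_apply, mul_comm]
  · have := integral_inner_sq h (WithLp.toLp 2 v)
    simp only [star_trivial]
    rw [← this]
    exact integral_nonneg fun x => sq_nonneg _

end SecondMoments

/-! ### The model: scores, information and identification -/

section Model

lemma Real.abs_log_sub_log_le {a b c : ℝ} (hc : 0 < c) (ha : c ≤ a) (hb : c ≤ b) :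
    |Real.log a - Real.log b| ≤ |a - b| / c := by
  have key : ∀ {a b : ℝ}, c ≤ a → c ≤ b → Real.log a - Real.log b ≤ |a - b| / c := by
    intro a b ha hb
    have ha0 := hc.trans_le ha
    have hb0 := hc.trans_le hb
    rw [← Real.log_div ha0.ne' hb0.ne']
    calc Real.log (a / b) ≤ a / b - 1 := Real.log_le_sub_one_of_pos (by positivity)
      _ = (a - b) / b := by field_simp
      _ ≤ |a - b| / b := by gcongr; exact le_abs_self _
      _ ≤ |a - b| / c := by gcongr
  refine abs_le.2 ⟨?_, key ha hb⟩
  have := key hb ha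
  rw [abs_sub_comm] at this
  linarith

variable {d p : ℕ} {ν : Measure (EuclideanSpace ℝ (Fin d))}
  {Z : Set (EuclideanSpace ℝ (Fin d))} {Θ N : Set (EuclideanSpace ℝ (Fin p))}
  {f : EuclideanSpace ℝ (Fin d) → EuclideanSpace ℝ (Fin p) → ℝ}
  {θ₀ : EuclideanSpace ℝ (Fin p)}

lemma modelLaw_absolutelyContinuous : modelLaw ν Z f θ₀ ≪ ν.restrict Z :=
  withDensity_absolutelyContinuous _ _

lemma IsDensityFamily.ae_modelLaw_mem (hf : IsDensityFamily ν Z Θ f) :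
    ∀ᵐ x ∂(modelLaw ν Z f θ₀), x ∈ Z :=
  modelLaw_absolutelyContinuous.ae_le (ae_restrict_mem hf.measurableSet)

lemma IsDensityFamily.integrable (hf : IsDensityFamily ν Z Θ f) {θ : EuclideanSpace ℝ (Fin p)}
    (hθ : θ ∈ Θ) : Integrable (fun x => f x θ) (ν.restrict Z) := by
  have hnn : 0 ≤ᵐ[ν.restrict Z] fun x => f x θ := by
    filter_upwards [ae_restrict_mem hf.measurableSet] with x hx using hf.nonneg x hx θ hθ
  rw [← lintegral_ofReal_ne_top_iff_integrable (hf.aemeasurable θ hθ).aestronglyMeasurable hnn,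
    hf.lintegral_eq_one θ hθ]
  exact ENNReal.one_ne_top

lemma IsDensityFamily.integral_eq_one (hf : IsDensityFamily ν Z Θ f)
    {θ : EuclideanSpace ℝ (Fin p)} (hθ : θ ∈ Θ) : ∫ x in Z, f x θ ∂ν = 1 := by
  have hnn : 0 ≤ᵐ[ν.restrict Z] fun x => f x θ := by
    filter_upwards [ae_restrict_mem hf.measurableSet] with x hx using hf.nonneg x hx θ hθ
  rw [integral_eq_lintegral_of_nonneg_ae hnn (hf.aemeasurable θ hθ).aestronglyMeasurable,
    hf.lintegral_eq_one θ hθ, ENNReal.toReal_one]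

lemma IsDensityFamily.integral_modelLaw (hf : IsDensityFamily ν Z Θ f) (hθ₀ : θ₀ ∈ Θ)
    {F : Type*} [NormedAddCommGroup F] [NormedSpace ℝ F] (h : EuclideanSpace ℝ (Fin d) → F) :
    ∫ x, h x ∂(modelLaw ν Z f θ₀) = ∫ x in Z, f x θ₀ • h x ∂ν := by
  rw [modelLaw, integral_withDensity_eq_integral_toReal_smul₀
    (hf.aemeasurable θ₀ hθ₀).ennreal_ofReal (.of_forall fun _ => ENNReal.ofReal_lt_top)]
  refine setIntegral_congr_fun hf.measurableSet fun x hx => ?_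
  simp only [ENNReal.toReal_ofReal (hf.nonneg x hx θ₀ hθ₀)]

lemma IsDensityFamily.integrable_modelLaw (hf : IsDensityFamily ν Z Θ f) (hθ₀ : θ₀ ∈ Θ)
    {F : Type*} [NormedAddCommGroup F] [NormedSpace ℝ F] {h : EuclideanSpace ℝ (Fin d) → F} :
    Integrable h (modelLaw ν Z f θ₀) ↔ Integrable (fun x => f x θ₀ • h x) (ν.restrict Z) := by
  rw [modelLaw, integrable_withDensity_iff_integrable_smul₀'
    (hf.aemeasurable θ₀ hθ₀).ennreal_ofReal (.of_forall fun _ => ENNReal.ofReal_lt_top)]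
  refine integrable_congr ?_
  filter_upwards [ae_restrict_mem hf.measurableSet] with x hx
  simp only [ENNReal.toReal_ofReal (hf.nonneg x hx θ₀ hθ₀)]

/-- Gibbs' inequality: the mean log-likelihood is maximal only at the true parameter. -/
lemma integral_log_lt_integral_log (hf : IsDensityFamily ν Z Θ f) (hθ₀ : θ₀ ∈ Θ)
    (hpos : ∀ x ∈ Z, ∀ θ ∈ Θ, 0 < f x θ) {θ : EuclideanSpace ℝ (Fin p)} (hθ : θ ∈ Θ)
    (hint : Integrable (fun x => Real.log (f x θ)) (modelLaw ν Z f θ₀))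
    (hint₀ : Integrable (fun x => Real.log (f x θ₀)) (modelLaw ν Z f θ₀))
    (hne : ¬ (fun x => f x θ) =ᵐ[ν.restrict Z] (fun x => f x θ₀)) :
    ∫ x, Real.log (f x θ) ∂(modelLaw ν Z f θ₀) < ∫ x, Real.log (f x θ₀) ∂(modelLaw ν Z f θ₀) := by
  by_contra! hle
  have hcancel : ∀ x ∈ Z, ∀ θ, f x θ₀ • (f x θ / f x θ₀) = f x θ := fun x hx θ => by
    rw [smul_eq_mul, mul_div_cancel₀ _ (hpos x hx θ₀ hθ₀).ne']
  have hratio : Integrable (fun x => f x θ / f x θ₀) (modelLaw ν Z f θ₀) := by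
    rw [hf.integrable_modelLaw hθ₀]
    refine (hf.integrable hθ).congr ?_
    filter_upwards [ae_restrict_mem hf.measurableSet] with x hx using (hcancel x hx θ).symm
  have hone : Integrable (fun _ => (1 : ℝ)) (modelLaw ν Z f θ₀) := by
    rw [hf.integrable_modelLaw hθ₀]
    simpa using hf.integrable hθ₀
  have hratio1 : ∫ x, f x θ / f x θ₀ ∂(modelLaw ν Z f θ₀) = 1 := by
    rw [hf.integral_modelLaw hθ₀, setIntegral_congr_fun hf.measurableSet
      (fun x hx => hcancel x hx θ), hf.integral_eq_one hθ]
  have hone1 : ∫ _, (1 : ℝ) ∂(modelLaw ν Z f θ₀) = 1 := by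
    rw [hf.integral_modelLaw hθ₀]
    simpa using hf.integral_eq_one hθ₀
  -- The nonnegative function `r - 1 - log r`, `r` the likelihood ratio, has integral at most `0`.
  set G : EuclideanSpace ℝ (Fin d) → ℝ := fun x =>
    f x θ / f x θ₀ - 1 - (Real.log (f x θ) - Real.log (f x θ₀)) with hG
  have hGint : Integrable G (modelLaw ν Z f θ₀) := (hratio.sub hone).sub (hint.sub hint₀)
  have hlogdiv : ∀ x ∈ Z, Real.log (f x θ) - Real.log (f x θ₀) = Real.log (f x θ / f x θ₀) :=
    fun x hx => (Real.log_div (hpos x hx θ hθ).ne' (hpos x hx θ₀ hθ₀).ne').symm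
  have hGnn : 0 ≤ᵐ[modelLaw ν Z f θ₀] G := by
    filter_upwards [hf.ae_modelLaw_mem] with x hx
    have := Real.log_le_sub_one_of_pos (div_pos (hpos x hx θ hθ) (hpos x hx θ₀ hθ₀))
    simp only [hG, Pi.zero_apply, hlogdiv x hx]
    linarith
  have hG0 : ∫ x, G x ∂(modelLaw ν Z f θ₀) = 0 := by
    refine le_antisymm ?_ (integral_nonneg_of_ae hGnn)
    have hdiff : Integrable (fun x => f x θ / f x θ₀ - 1) (modelLaw ν Z f θ₀) := hratio.sub hone
    have hdiffl : Integrable (fun x => Real.log (f x θ) - Real.log (f x θ₀))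
      (modelLaw ν Z f θ₀) := hint.sub hint₀
    rw [hG, integral_sub hdiff hdiffl, integral_sub hratio hone, integral_sub hint hint₀, hratio1,
      hone1]
    linarith
  have hGz := (integral_eq_zero_iff_of_nonneg_ae hGnn hGint).1 hG0
  rw [modelLaw, Filter.EventuallyEq, ae_withDensity_iff'
    (hf.aemeasurable θ₀ hθ₀).ennreal_ofReal] at hGz
  refine hne ?_
  filter_upwards [hGz, ae_restrict_mem hf.measurableSet] with x hx hxZ
  have h0 := hpos x hxZ θ₀ hθ₀
  have hx0 : G x = 0 := hx (ENNReal.ofReal_pos.2 h0).ne'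
  simp only [hG, hlogdiv x hxZ] at hx0
  by_contra hneq
  have := Real.log_lt_sub_one_of_pos (div_pos (hpos x hxZ θ hθ) h0)
    (fun h => hneq ((div_eq_one_iff_eq h0.ne').1 h))
  linarith

lemma differentiableAt_of_contDiffOn_two (hN : IsOpen N) {g : EuclideanSpace ℝ (Fin p) → ℝ}
    (hg : ContDiffOn ℝ 2 g N) {θ : EuclideanSpace ℝ (Fin p)} (hθ : θ ∈ N) :
    DifferentiableAt ℝ g θ :=
  (hg.contDiffAt (hN.mem_nhds hθ)).differentiableAt two_ne_zero

lemma aestronglyMeasurable_gradient (hN : IsOpen N)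
    {g : EuclideanSpace ℝ (Fin d) → EuclideanSpace ℝ (Fin p) → ℝ}
    {μ : Measure (EuclideanSpace ℝ (Fin d))}
    (hm : ∀ θ ∈ N, AEStronglyMeasurable (fun x => g x θ) μ)
    (hg : ∀ᵐ x ∂μ, ContDiffOn ℝ 2 (g x) N) {θ : EuclideanSpace ℝ (Fin p)} (hθ : θ ∈ N) :
    AEStronglyMeasurable (fun x => gradient (g x) θ) μ := by
  simp only [← rieszVector_fderiv]
  refine (rieszVector p).continuous.comp_aestronglyMeasurable
    (aestronglyMeasurable_hasFDerivAt hN hm hθ (hg.mono fun x hx => ?_))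
  exact (differentiableAt_of_contDiffOn_two hN hx hθ).hasFDerivAt

lemma aestronglyMeasurable_hessian (hN : IsOpen N)
    {g : EuclideanSpace ℝ (Fin d) → EuclideanSpace ℝ (Fin p) → ℝ}
    {μ : Measure (EuclideanSpace ℝ (Fin d))}
    (hm : ∀ θ ∈ N, AEStronglyMeasurable (fun x => g x θ) μ)
    (hg : ∀ᵐ x ∂μ, ContDiffOn ℝ 2 (g x) N) {θ : EuclideanSpace ℝ (Fin p)} (hθ : θ ∈ N) :
    AEStronglyMeasurable (fun x => hessian (g x) θ) μ :=
  aestronglyMeasurable_hasFDerivAt hN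
    (fun _ hθ' => aestronglyMeasurable_gradient hN hm hg hθ') hθ
    (hg.mono fun _ hx => hasFDerivAt_gradient hN hx hθ)

/-- The gradient of the density integrates to zero, as the density integrates to one. -/
lemma integral_gradient_density_eq_zero (hf : IsDensityFamily ν Z Θ f) (hN : IsOpen N)
    (hNΘ : N ⊆ Θ) (hC : ∀ x ∈ Z, ContDiffOn ℝ 2 (f x) N)
    (hgrad : ∫⁻ x in Z, ⨆ θ ∈ N, ‖gradient (f x) θ‖ₑ ∂ν < ∞)
    {θ : EuclideanSpace ℝ (Fin p)} (hθ : θ ∈ N) :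
    Integrable (fun x => gradient (f x) θ) (ν.restrict Z) ∧ ∫ x in Z, gradient (f x) θ ∂ν = 0 := by
  have hCae : ∀ᵐ x ∂(ν.restrict Z), ContDiffOn ℝ 2 (f x) N :=
    (ae_restrict_mem hf.measurableSet).mono hC
  have hm : ∀ θ ∈ N, AEStronglyMeasurable (fun x => f x θ) (ν.restrict Z) := fun θ hθ =>
    (hf.aemeasurable θ (hNΘ hθ)).aestronglyMeasurable
  obtain ⟨b, hb, hgb⟩ := exists_integrable_of_lintegral_biSup
    (g := fun x θ => gradient (f x) θ)
    (hCae.mono fun x hx => (contDiffOn_gradient hN hx).continuousOn)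
    (fun θ hθ => aestronglyMeasurable_gradient hN hm hCae hθ) hgrad
  have hD : ∀ᵐ x ∂(ν.restrict Z), ∀ θ ∈ N, HasFDerivAt (f x) (fderiv ℝ (f x) θ) θ :=
    hCae.mono fun x hx θ hθ =>
      (differentiableAt_of_contDiffOn_two hN hx hθ).hasFDerivAt
  have hnorm : ∀ᵐ x ∂(ν.restrict Z), ∀ θ ∈ N, ‖fderiv ℝ (f x) θ‖ ≤ b x :=
    hgb.mono fun x hx θ hθ => by
      rw [← toDual_gradient, LinearIsometryEquiv.norm_map]
      exact hx θ hθ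
  have hzero := integral_hasFDerivAt_eq_zero hN (fun θ hθ => hf.integrable (hNΘ hθ)) hD hb hnorm
    (fun θ hθ => hf.integral_eq_one (hNΘ hθ)) hθ
  have hint : Integrable (fun x => fderiv ℝ (f x) θ) (ν.restrict Z) :=
    hb.mono' (aestronglyMeasurable_hasFDerivAt hN hm hθ (hD.mono fun x hx => hx θ hθ))
      (hnorm.mono fun x hx => hx θ hθ)
  simp only [← rieszVector_fderiv]
  refine ⟨(rieszVector p).integrable_comp hint, ?_⟩
  rw [(rieszVector p).integral_comp_comm hint, hzero, map_zero]

/-- The Hessian of the density integrates to zero. -/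
lemma integral_hessian_density_eq_zero (hf : IsDensityFamily ν Z Θ f) (hN : IsOpen N)
    (hNΘ : N ⊆ Θ) (hC : ∀ x ∈ Z, ContDiffOn ℝ 2 (f x) N)
    (hgrad : ∫⁻ x in Z, ⨆ θ ∈ N, ‖gradient (f x) θ‖ₑ ∂ν < ∞)
    (hhess : ∫⁻ x in Z, ⨆ θ ∈ N, ‖hessian (f x) θ‖ₑ ∂ν < ∞)
    {θ : EuclideanSpace ℝ (Fin p)} (hθ : θ ∈ N) :
    Integrable (fun x => hessian (f x) θ) (ν.restrict Z) ∧ ∫ x in Z, hessian (f x) θ ∂ν = 0 := by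
  have hCae : ∀ᵐ x ∂(ν.restrict Z), ContDiffOn ℝ 2 (f x) N :=
    (ae_restrict_mem hf.measurableSet).mono hC
  have hm : ∀ θ ∈ N, AEStronglyMeasurable (fun x => f x θ) (ν.restrict Z) := fun θ hθ =>
    (hf.aemeasurable θ (hNΘ hθ)).aestronglyMeasurable
  obtain ⟨b, hb, hgb⟩ := exists_integrable_of_lintegral_biSup
    (g := fun x θ => hessian (f x) θ)
    (hCae.mono fun x hx => continuousOn_hessian hN hx)
    (fun θ hθ => aestronglyMeasurable_hessian hN hm hCae hθ) hhess
  refine ⟨hb.mono' (aestronglyMeasurable_hessian hN hm hCae hθ) (hgb.mono fun x hx => hx θ hθ), ?_⟩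
  exact integral_hasFDerivAt_eq_zero hN
    (fun θ hθ => (integral_gradient_density_eq_zero hf hN hNΘ hC hgrad hθ).1)
    (hCae.mono fun x hx θ hθ => hasFDerivAt_gradient hN hx hθ) hb hgb
    (fun θ hθ => (integral_gradient_density_eq_zero hf hN hNΘ hC hgrad hθ).2) hθ

/-- The score has mean zero. -/
lemma integral_score_eq_zero (hf : IsDensityFamily ν Z Θ f) (hN : IsOpen N)
    (hNΘ : N ⊆ Θ) (hθ₀ : θ₀ ∈ N) (hC : ∀ x ∈ Z, ContDiffOn ℝ 2 (f x) N)
    (hpos : ∀ x ∈ Z, ∀ θ ∈ N, 0 < f x θ)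
    (hgrad : ∫⁻ x in Z, ⨆ θ ∈ N, ‖gradient (f x) θ‖ₑ ∂ν < ∞) :
    ∫ x, gradient (fun θ => Real.log (f x θ)) θ₀ ∂(modelLaw ν Z f θ₀) = 0 := by
  rw [hf.integral_modelLaw (hNΘ hθ₀),
    ← (integral_gradient_density_eq_zero hf hN hNΘ hC hgrad hθ₀).2]
  refine setIntegral_congr_fun hf.measurableSet fun x hx => ?_
  have h0 := (hpos x hx θ₀ hθ₀).ne'
  simp only [gradient_log (differentiableAt_of_contDiffOn_two hN (hC x hx) hθ₀) h0]
  rw [smul_inv_smul₀ h0]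

/-- The information equality: the mean Hessian of the log-likelihood is minus the Fisher
information. -/
lemma integral_hessian_log_apply (hf : IsDensityFamily ν Z Θ f) (hN : IsOpen N)
    (hNΘ : N ⊆ Θ) (hθ₀ : θ₀ ∈ N) (hC : ∀ x ∈ Z, ContDiffOn ℝ 2 (f x) N)
    (hpos : ∀ x ∈ Z, ∀ θ ∈ N, 0 < f x θ)
    (hgrad : ∫⁻ x in Z, ⨆ θ ∈ N, ‖gradient (f x) θ‖ₑ ∂ν < ∞)
    (hhess : ∫⁻ x in Z, ⨆ θ ∈ N, ‖hessian (f x) θ‖ₑ ∂ν < ∞)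
    (hinfo : ∀ i j, Integrable (fun x => gradient (fun θ => Real.log (f x θ)) θ₀ i *
      gradient (fun θ => Real.log (f x θ)) θ₀ j) (modelLaw ν Z f θ₀))
    (hint : Integrable (fun x => hessian (fun θ => Real.log (f x θ)) θ₀) (modelLaw ν Z f θ₀))
    (v : EuclideanSpace ℝ (Fin p)) :
    (∫ x, hessian (fun θ => Real.log (f x θ)) θ₀ ∂(modelLaw ν Z f θ₀)) v
      = -Matrix.toEuclideanCLM (𝕜 := ℝ) (fisherInformation ν Z f θ₀) v := by
  obtain ⟨hHint, hH0⟩ := integral_hessian_density_eq_zero hf hN hNΘ hC hgrad hhess hθ₀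
  set s : EuclideanSpace ℝ (Fin d) → EuclideanSpace ℝ (Fin p) :=
    fun x => gradient (fun θ => Real.log (f x θ)) θ₀ with hs
  have hpt : ∀ x ∈ Z, f x θ₀ • hessian (fun θ => Real.log (f x θ)) θ₀ = hessian (f x) θ₀
      - f x θ₀ • (innerSL ℝ (s x)).smulRight (s x) := fun x hx =>
    smul_hessian_log hN (hC x hx) (hpos x hx) hθ₀
  ext i
  have hcoord : ∀ L : EuclideanSpace ℝ (Fin p) →L[ℝ] EuclideanSpace ℝ (Fin p),
      L v i = (EuclideanSpace.proj (𝕜 := ℝ) i ∘L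
        ContinuousLinearMap.apply ℝ (EuclideanSpace ℝ (Fin p)) v) L := fun L => rfl
  set Λ := EuclideanSpace.proj (𝕜 := ℝ) i ∘L
        ContinuousLinearMap.apply ℝ (EuclideanSpace ℝ (Fin p)) v with hΛ
  have hΛH : ∫ x in Z, Λ (hessian (f x) θ₀) ∂ν = 0 := by
    rw [Λ.integral_comp_comm hHint, hH0, map_zero]
  have hrank : ∀ x, Λ ((innerSL ℝ (s x)).smulRight (s x)) = inner ℝ (s x) v * s x i := by
    intro x
    simp [hΛ]
  have hII : Integrable (fun x => f x θ₀ • (inner ℝ (s x) v * s x i)) (ν.restrict Z) :=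
    (hf.integrable_modelLaw (hNΘ hθ₀)).1 (integrable_inner_mul_apply hinfo v i)
  rw [hcoord, ← Λ.integral_comp_comm hint, hf.integral_modelLaw (hNΘ hθ₀)]
  have hcongr : ∫ x in Z, f x θ₀ • Λ (hessian (fun θ => Real.log (f x θ)) θ₀) ∂ν
      = ∫ x in Z, Λ (hessian (f x) θ₀) - f x θ₀ • (inner ℝ (s x) v * s x i) ∂ν := by
    refine setIntegral_congr_fun hf.measurableSet fun x hx => ?_
    simp only
    rw [← map_smul, hpt x hx, map_sub, map_smul, hrank]
  rw [hcongr, integral_sub (Λ.integrable_comp hHint) hII, hΛH, zero_sub,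
    ← hf.integral_modelLaw (hNΘ hθ₀), integral_inner_mul_apply hinfo]
  simp only [PiLp.neg_apply, Matrix.ofLp_toEuclideanCLM]
  rfl

/-- An approximation of a density and of its gradient up to `ε` gives an approximation of the
score. -/
lemma norm_gradient_log_sub_le {g h : EuclideanSpace ℝ (Fin p) → ℝ}
    {θ : EuclideanSpace ℝ (Fin p)} {c ε : ℝ} (hc : 0 < c)
    (hg : DifferentiableAt ℝ g θ) (hh : DifferentiableAt ℝ h θ) (hgc : c ≤ g θ) (hhpos : 0 < h θ)
    (hval : |g θ - h θ| ≤ ε) (hgrad : ‖gradient g θ - gradient h θ‖ ≤ ε) :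
    ‖gradient (fun θ => Real.log (g θ)) θ - gradient (fun θ => Real.log (h θ)) θ‖
      ≤ ε / c * (1 + ‖gradient (fun θ => Real.log (h θ)) θ‖) := by
  have hg0 := hc.trans_le hgc
  set s := gradient (fun θ => Real.log (h θ)) θ with hs
  have hhs : gradient h θ = h θ • s := by
    rw [hs, gradient_log hh hhpos.ne', smul_inv_smul₀ hhpos.ne']
  have hsplit : gradient (fun θ => Real.log (g θ)) θ - s
      = (g θ)⁻¹ • ((gradient g θ - gradient h θ) - (g θ - h θ) • s) := by
    rw [gradient_log hg hg0.ne', hhs, smul_sub, smul_sub, smul_smul, smul_smul, mul_sub,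
      inv_mul_cancel₀ hg0.ne', sub_smul, one_smul]
    abel
  rw [hsplit, norm_smul, norm_inv, Real.norm_of_nonneg hg0.le]
  calc (g θ)⁻¹ * ‖(gradient g θ - gradient h θ) - (g θ - h θ) • s‖
      ≤ c⁻¹ * (ε + ε * ‖s‖) := by
        gcongr
        refine (norm_sub_le _ _).trans (add_le_add hgrad ?_)
        rw [norm_smul, Real.norm_eq_abs]
        gcongr
    _ = ε / c * (1 + ‖s‖) := by field_simp

end Model

/-! ### The effect of approximating the likelihood -/

section Approximation

variable {d p : ℕ} {Z : Set (EuclideanSpace ℝ (Fin d))} {Θ : Set (EuclideanSpace ℝ (Fin p))}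
  {g f : EuclideanSpace ℝ (Fin d) → EuclideanSpace ℝ (Fin p) → ℝ} {ε : ℝ}

lemma abs_sub_le_of_approxError (h : approxError Z Θ g f ≤ ENNReal.ofReal ε) (hε : 0 ≤ ε)
    {x : EuclideanSpace ℝ (Fin d)} (hx : x ∈ Z) {θ : EuclideanSpace ℝ (Fin p)} (hθ : θ ∈ Θ) :
    |g x θ - f x θ| ≤ ε := by
  have h1 : ‖g x θ - f x θ‖ₑ ≤ valueError Z Θ g f := by
    refine le_trans ?_ (le_iSup₂ (f := fun x (_ : x ∈ Z) => ⨆ θ ∈ Θ, ‖g x θ - f x θ‖ₑ) x hx)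
    exact le_iSup₂ (f := fun θ (_ : θ ∈ Θ) => ‖g x θ - f x θ‖ₑ) θ hθ
  have h2 := h1.trans (le_self_add.trans h)
  rwa [← ofReal_norm, ENNReal.ofReal_le_ofReal_iff hε, Real.norm_eq_abs] at h2

lemma norm_gradient_sub_le_of_approxError (h : approxError Z Θ g f ≤ ENNReal.ofReal ε)
    (hε : 0 ≤ ε) {x : EuclideanSpace ℝ (Fin d)} (hx : x ∈ Z) {θ : EuclideanSpace ℝ (Fin p)}
    (hθ : θ ∈ interior Θ) : ‖gradient (g x) θ - gradient (f x) θ‖ ≤ ε := by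
  have h1 : ‖gradient (g x) θ - gradient (f x) θ‖ₑ ≤ gradientError Z Θ g f := by
    refine le_trans ?_ (le_iSup₂
      (f := fun x (_ : x ∈ Z) => ⨆ θ ∈ interior Θ, ‖gradient (g x) θ - gradient (f x) θ‖ₑ) x hx)
    exact le_iSup₂ (f := fun θ (_ : θ ∈ interior Θ) => ‖gradient (g x) θ - gradient (f x) θ‖ₑ) θ hθ
  have h2 := h1.trans (le_add_self.trans h)
  rwa [← ofReal_norm, ENNReal.ofReal_le_ofReal_iff hε] at h2

lemma logLikelihood_eq (x : ℕ → EuclideanSpace ℝ (Fin d)) (n : ℕ) (θ : EuclideanSpace ℝ (Fin p)) :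
    logLikelihood g x n θ = (n : ℝ)⁻¹ * ∑ i ∈ Finset.range n, Real.log (g (x i) θ) := by
  rw [logLikelihood, one_div]

lemma abs_logLikelihood_sub_le {c : ℝ} (hc : 0 < c) (hε : 0 ≤ ε)
    {x : ℕ → EuclideanSpace ℝ (Fin d)} (n : ℕ) {θ : EuclideanSpace ℝ (Fin p)}
    (hg : ∀ i, c ≤ g (x i) θ) (hf : ∀ i, c ≤ f (x i) θ)
    (h : ∀ i, |g (x i) θ - f (x i) θ| ≤ ε) :
    |logLikelihood g x n θ - logLikelihood f x n θ| ≤ ε / c := by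
  rw [logLikelihood_eq, logLikelihood_eq, ← mul_sub, ← Finset.sum_sub_distrib, abs_mul,
    abs_of_nonneg (by positivity : (0 : ℝ) ≤ (n : ℝ)⁻¹)]
  calc (n : ℝ)⁻¹ * |∑ i ∈ Finset.range n, (Real.log (g (x i) θ) - Real.log (f (x i) θ))|
      ≤ (n : ℝ)⁻¹ * ∑ i ∈ Finset.range n, ε / c := by
        gcongr
        refine (Finset.abs_sum_le_sum_abs _ _).trans (Finset.sum_le_sum fun i _ => ?_)
        exact (Real.abs_log_sub_log_le hc (hg i) (hf i)).trans (by gcongr; exact h i)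
    _ = ((n : ℝ)⁻¹ * n) * (ε / c) := by simp [mul_assoc]
    _ ≤ 1 * (ε / c) := by
        gcongr
        exact inv_mul_le_one
    _ = ε / c := one_mul _

/-- The first-order condition at an interior maximizer of the likelihood. -/
lemma average_gradient_log_eq_zero_of_isMaxOn {x : ℕ → EuclideanSpace ℝ (Fin d)} {n : ℕ}
    {θ : EuclideanSpace ℝ (Fin p)} (hθ : θ ∈ interior Θ)
    (hd : ∀ i, DifferentiableAt ℝ (g (x i)) θ) (h0 : ∀ i, g (x i) θ ≠ 0)
    (hmax : IsMaxOn (logLikelihood g x n) Θ θ) :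
    (n : ℝ)⁻¹ • ∑ i ∈ Finset.range n, gradient (fun θ => Real.log (g (x i) θ)) θ = 0 := by
  have hloc : IsLocalMax (logLikelihood g x n) θ :=
    hmax.isLocalMax (mem_interior_iff_mem_nhds.1 hθ)
  have hderiv : HasFDerivAt (logLikelihood g x n)
      ((n : ℝ)⁻¹ • ∑ i ∈ Finset.range n, fderiv ℝ (fun θ => Real.log (g (x i) θ)) θ) θ := by
    have h1 : HasFDerivAt (fun θ => ∑ i ∈ Finset.range n, Real.log (g (x i) θ))
        (∑ i ∈ Finset.range n, fderiv ℝ (fun θ => Real.log (g (x i) θ)) θ) θ :=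
      HasFDerivAt.fun_sum fun i _ => ((hd i).log (h0 i)).hasFDerivAt
    refine (h1.const_mul ((n : ℝ)⁻¹)).congr_of_eventuallyEq (.of_forall fun θ' => ?_)
    exact logLikelihood_eq _ _ _
  have hz := congrArg (rieszVector p) (hloc.hasFDerivAt_eq_zero hderiv)
  simpa only [map_smul, map_sum, rieszVector_fderiv, map_zero] using hz

/-- At an interior maximizer of the approximated likelihood the exact score is small. -/
lemma norm_average_score_le {c : ℝ} (hc : 0 < c) (hε : 0 ≤ ε)
    {x : ℕ → EuclideanSpace ℝ (Fin d)} {n : ℕ} {θ : EuclideanSpace ℝ (Fin p)}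
    (hθ : θ ∈ interior Θ) (hgd : ∀ i, DifferentiableAt ℝ (g (x i)) θ)
    (hfd : ∀ i, DifferentiableAt ℝ (f (x i)) θ)
    (hg : ∀ i, c ≤ g (x i) θ) (hf : ∀ i, 0 < f (x i) θ)
    (hval : ∀ i, |g (x i) θ - f (x i) θ| ≤ ε)
    (hgrad : ∀ i, ‖gradient (g (x i)) θ - gradient (f (x i)) θ‖ ≤ ε)
    {b : EuclideanSpace ℝ (Fin d) → ℝ}
    (hb : ∀ i, ‖gradient (fun θ => Real.log (f (x i) θ)) θ‖ ≤ b (x i))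
    (hmax : IsMaxOn (logLikelihood g x n) Θ θ) :
    ‖(n : ℝ)⁻¹ • ∑ i ∈ Finset.range n, gradient (fun θ => Real.log (f (x i) θ)) θ‖
      ≤ ε / c * (1 + (n : ℝ)⁻¹ * ∑ i ∈ Finset.range n, b (x i)) := by
  have hzero := average_gradient_log_eq_zero_of_isMaxOn hθ hgd
    (fun i => (hc.trans_le (hg i)).ne') hmax
  rw [← norm_neg, ← zero_sub, ← hzero, ← smul_sub, ← Finset.sum_sub_distrib, norm_smul,
    Real.norm_of_nonneg (by positivity)]
  calc (n : ℝ)⁻¹ * ‖∑ i ∈ Finset.range n, (gradient (fun θ => Real.log (g (x i) θ)) θ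
        - gradient (fun θ => Real.log (f (x i) θ)) θ)‖
      ≤ (n : ℝ)⁻¹ * ∑ i ∈ Finset.range n, ε / c * (1 + b (x i)) := by
        gcongr
        refine (norm_sum_le _ _).trans (Finset.sum_le_sum fun i _ => ?_)
        refine (norm_gradient_log_sub_le hc (hgd i) (hfd i) (hg i) (hf i) (hval i)
          (hgrad i)).trans ?_
        gcongr
        exact hb i
    _ = ε / c * ((n : ℝ)⁻¹ * n + (n : ℝ)⁻¹ * ∑ i ∈ Finset.range n, b (x i)) := by
        rw [← Finset.mul_sum, Finset.sum_add_distrib, Finset.sum_const, Finset.card_range,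
          nsmul_eq_mul]
        ring
    _ ≤ ε / c * (1 + (n : ℝ)⁻¹ * ∑ i ∈ Finset.range n, b (x i)) := by
        gcongr
        exact inv_mul_le_one

end Approximation

/-! ### Asymptotics of the maximum approximated likelihood estimator -/

section Estimator

variable {d p : ℕ} {Ω : Type*} [MeasurableSpace Ω] {P : Measure Ω}
  {ν : Measure (EuclideanSpace ℝ (Fin d))} {Z : Set (EuclideanSpace ℝ (Fin d))}
  {Θ N : Set (EuclideanSpace ℝ (Fin p))}
  {f : EuclideanSpace ℝ (Fin d) → EuclideanSpace ℝ (Fin p) → ℝ}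
  {θ₀ : EuclideanSpace ℝ (Fin p)} {z : ℕ → Ω → EuclideanSpace ℝ (Fin d)}
  {gt : ℕ → Ω → EuclideanSpace ℝ (Fin d) → EuclideanSpace ℝ (Fin p) → ℝ}
  {θhat : ℕ → Ω → EuclideanSpace ℝ (Fin p)}

lemma withHighProb_approxError_le
    (h_rate : TendstoInMeasure P
      (fun (n : ℕ) ω => ENNReal.ofReal (√(n : ℝ)) * approxError Z Θ (gt n ω) f)
      atTop (fun _ => 0)) {ε : ℝ} (hε : 0 < ε) :
    WithHighProb P (fun n ω => 1 ≤ √(n : ℝ) ∧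
      approxError Z Θ (gt n ω) f ≤ ENNReal.ofReal (ε / √(n : ℝ))) := by
  refine (withHighProb_lt h_rate (ENNReal.ofReal_pos.2 hε)).mono ?_
  filter_upwards [eventually_ge_atTop 1] with n hn
  refine .of_forall fun ω hω => ?_
  have h1 : 1 ≤ √(n : ℝ) := Real.one_le_sqrt.2 (by exact_mod_cast hn)
  have h0 : 0 < √(n : ℝ) := by linarith
  refine ⟨h1, ?_⟩
  rw [ENNReal.ofReal_div_of_pos h0, ENNReal.le_div_iff_mul_le
    (.inl (ENNReal.ofReal_pos.2 h0).ne') (.inl ENNReal.ofReal_ne_top), mul_comm]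
  exact hω.le

variable [IsProbabilityMeasure P]

/-- The density is continuous in the parameter at every sample point, as a uniform limit of its
approximations. -/
lemma continuousOn_density
    (h_cont : ∀ᵐ ω ∂P, ∀ n, ∀ x ∈ Z, ContinuousOn (gt n ω x) Θ)
    (h_rate : TendstoInMeasure P
      (fun (n : ℕ) ω => ENNReal.ofReal (√(n : ℝ)) * approxError Z Θ (gt n ω) f)
      atTop (fun _ => 0)) {x : EuclideanSpace ℝ (Fin d)} (hx : x ∈ Z) :
    ContinuousOn (f x) Θ := by
  refine continuousOn_of_uniform_approx_of_continuousOn fun u hu => ?_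
  obtain ⟨ε, hε, hεu⟩ := Metric.mem_uniformity_dist.1 hu
  obtain ⟨n, ω, hcont, h1, herr⟩ := (withHighProb_approxError_le h_rate (half_pos hε)).exists
    (B := fun n ω => ContinuousOn (gt n ω x) Θ ∧ 1 ≤ √(n : ℝ) ∧
      approxError Z Θ (gt n ω) f ≤ ENNReal.ofReal (ε / 2 / √(n : ℝ)))
    (h_cont.mono fun ω hω n h => ⟨hω n x hx, h⟩)
  refine ⟨gt n ω x, hcont, fun θ hθ => hεu ?_⟩
  have hle : ε / 2 / √(n : ℝ) ≤ ε / 2 := div_le_self (by positivity) h1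
  have := abs_sub_le_of_approxError herr (by positivity) hx hθ
  rw [dist_comm, Real.dist_eq]
  linarith

/-- Consistency of the maximum approximated likelihood estimator. -/
lemma withHighProb_dist_lt_of_isMaxOn (hf : IsDensityFamily ν Z Θ f)
    (hz_law : ∀ i, HasLaw (z i) (modelLaw ν Z f θ₀) P) (hz_indep : iIndepFun z P)
    (hML : MLConsistencyConditions ν Z Θ f θ₀)
    {δ : ℝ} (hδ : 0 < δ) (hδf : ∀ x ∈ Z, ∀ θ ∈ Θ, δ ≤ f x θ)
    (h_cont : ∀ᵐ ω ∂P, ∀ n, ∀ x ∈ Z, ContinuousOn (gt n ω x) Θ)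
    (h_rate : TendstoInMeasure P
      (fun (n : ℕ) ω => ENNReal.ofReal (√(n : ℝ)) * approxError Z Θ (gt n ω) f)
      atTop (fun _ => 0))
    (hmax : WithHighProb P (fun n ω => θhat n ω ∈ Θ ∧
      IsMaxOn (logLikelihood (gt n ω) (fun i => z i ω) n) Θ (θhat n ω)))
    {ε : ℝ} (hε : 0 < ε) : WithHighProb P (fun n ω => dist (θhat n ω) θ₀ < ε) := by
  have hpos : ∀ x ∈ Z, ∀ θ ∈ Θ, 0 < f x θ := fun x hx θ hθ => hδ.trans_le (hδf x hx θ hθ)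
  have hc : ∀ᵐ x ∂(modelLaw ν Z f θ₀), ContinuousOn (fun θ => Real.log (f x θ)) Θ :=
    hf.ae_modelLaw_mem.mono fun x hx =>
      (continuousOn_density h_cont h_rate hx).log fun θ hθ => (hpos x hx θ hθ).ne'
  have hm : ∀ θ ∈ Θ, AEStronglyMeasurable (fun x => Real.log (f x θ)) (modelLaw ν Z f θ₀) :=
    fun θ hθ => ((hf.aemeasurable θ hθ).mono_ac
      modelLaw_absolutelyContinuous).log.aestronglyMeasurable
  obtain ⟨b, hb, hlb⟩ := exists_integrable_of_lintegral_biSup hc hm hML.dominated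
  have hint : ∀ θ ∈ Θ, Integrable (fun x => Real.log (f x θ)) (modelLaw ν Z f θ₀) := fun θ hθ =>
    hb.mono' (hm θ hθ) (hlb.mono fun x hx => hx θ hθ)
  refine withHighProb_dist_lt_of_approx_max hz_law hz_indep hML.isCompact hc hm hb hlb hML.mem
    (fun θ hθ hne => integral_log_lt_integral_log hf hML.mem hpos hθ (hint θ hθ)
      (hint θ₀ hML.mem) (hML.identified θ hθ (dist_pos.1 hne)))
    (hmax.mono (.of_forall fun n => .of_forall fun ω h => h.1)) (fun κ hκ => ?_) hε
  -- An error of `e` in the density costs at most `e / (δ / 2)` in the log-likelihood.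
  set e : ℝ := min (δ / 2) (κ * δ / 4) with he
  have he0 : 0 < e := by positivity
  refine ((withHighProb_approxError_le h_rate he0).and hmax).mono (.of_forall fun n => ?_)
  filter_upwards [ae_forall_sample hz_law hf.ae_modelLaw_mem] with ω hω
  rintro ⟨⟨h1, herr⟩, hmem, hmaxω⟩
  have hle : e / √(n : ℝ) ≤ e := div_le_self he0.le h1
  have hval : ∀ θ ∈ Θ, ∀ i, |gt n ω (z i ω) θ - f (z i ω) θ| ≤ e := fun θ hθ i =>
    (abs_sub_le_of_approxError herr (by positivity) (hω i) hθ).trans hle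
  have hL : ∀ θ ∈ Θ, |logLikelihood (gt n ω) (fun i => z i ω) n θ
      - logLikelihood f (fun i => z i ω) n θ| ≤ κ / 2 := by
    intro θ hθ
    refine (abs_logLikelihood_sub_le (half_pos hδ) he0.le n (fun i => ?_) (fun i => ?_)
      (hval θ hθ)).trans ?_
    · have h2 := (abs_le.1 (hval θ hθ i)).1
      have h3 := hδf (z i ω) (hω i) θ hθ
      have h4 : e ≤ δ / 2 := min_le_left _ _
      linarith
    · linarith [hδf (z i ω) (hω i) θ hθ]
    · rw [div_le_iff₀ (half_pos hδ)]
      have : e ≤ κ * δ / 4 := min_le_right _ _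
      linarith
  rw [← logLikelihood_eq, ← logLikelihood_eq (g := f) (fun i => z i ω)]
  have h2 := (abs_le.1 (hL θ₀ hML.mem)).1
  have h3 := (abs_le.1 (hL _ hmem)).2
  have h4 := isMaxOn_iff.1 hmaxω θ₀ hML.mem
  linarith

/-- The estimator is an asymptotic root of the exact likelihood equation, with an error of smaller
order than `n ^ (-1 / 2)`. -/
lemma withHighProb_sqrt_mul_norm_average_score_lt (hf : IsDensityFamily ν Z Θ f)
    (hz_law : ∀ i, HasLaw (z i) (modelLaw ν Z f θ₀) P) (hz_indep : iIndepFun z P)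
    {δ : ℝ} (hδ : 0 < δ) (hδf : ∀ x ∈ Z, ∀ θ ∈ Θ, δ ≤ f x θ)
    (hN : IsOpen N) (hNΘ : N ⊆ Θ) (hC : ∀ x ∈ Z, ContDiffOn ℝ 2 (f x) N)
    (h_smooth : ∀ᵐ ω ∂P, ∀ n, ∀ x ∈ Z, ContDiffOn ℝ 2 (gt n ω x) (interior Θ))
    (h_rate : TendstoInMeasure P
      (fun (n : ℕ) ω => ENNReal.ofReal (√(n : ℝ)) * approxError Z Θ (gt n ω) f)
      atTop (fun _ => 0))
    (hmax : WithHighProb P (fun n ω => θhat n ω ∈ Θ ∧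
      IsMaxOn (logLikelihood (gt n ω) (fun i => z i ω) n) Θ (θhat n ω)))
    (hmem : WithHighProb P (fun n ω => θhat n ω ∈ N))
    {b : EuclideanSpace ℝ (Fin d) → ℝ} (hb : Integrable b (modelLaw ν Z f θ₀))
    (hsb : ∀ᵐ x ∂(modelLaw ν Z f θ₀), ∀ θ ∈ N, ‖gradient (fun θ => Real.log (f x θ)) θ‖ ≤ b x)
    {ε : ℝ} (hε : 0 < ε) :
    WithHighProb P (fun n ω => √(n : ℝ) * ‖(n : ℝ)⁻¹ • ∑ i ∈ Finset.range n,
      gradient (fun θ => Real.log (f (z i ω) θ)) (θhat n ω)‖ < ε) := by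
  set B : ℝ := |∫ x, b x ∂(modelLaw ν Z f θ₀)| + 1 with hB
  have hB0 : 0 < B := by positivity
  set e : ℝ := min (δ / 2) (ε * δ / (4 * (1 + B))) with he
  have he0 : 0 < e := by positivity
  have havg := withHighProb_average_lt hz_law hz_indep hb (c := B)
    (by linarith [le_abs_self (∫ x, b x ∂(modelLaw ν Z f θ₀))])
  refine ((((withHighProb_approxError_le h_rate he0).and hmax).and hmem).and havg).mono
    (.of_forall fun n => ?_)
  filter_upwards [ae_forall_sample hz_law hf.ae_modelLaw_mem, ae_forall_sample hz_law hsb,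
    h_smooth] with ω hω hωb hsm
  rintro ⟨⟨⟨⟨h1, herr⟩, hmemΘ, hmaxω⟩, hθN⟩, havg⟩
  have hn0 : 0 < √(n : ℝ) := by linarith
  have hint : θhat n ω ∈ interior Θ := interior_maximal hNΘ hN hθN
  have hen0 : 0 ≤ e / √(n : ℝ) := by positivity
  have hval : ∀ i, |gt n ω (z i ω) (θhat n ω) - f (z i ω) (θhat n ω)| ≤ e / √(n : ℝ) := fun i =>
    abs_sub_le_of_approxError herr hen0 (hω i) hmemΘ
  have hlow : ∀ i, δ / 2 ≤ gt n ω (z i ω) (θhat n ω) := by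
    intro i
    have h2 := (abs_le.1 (hval i)).1
    have h3 := hδf (z i ω) (hω i) _ hmemΘ
    have h4 : e ≤ δ / 2 := min_le_left _ _
    have h5 : e / √(n : ℝ) ≤ e := div_le_self he0.le h1
    linarith
  have hscore := norm_average_score_le (x := fun i => z i ω) (half_pos hδ) hen0 hint
    (fun i => differentiableAt_of_contDiffOn_two isOpen_interior (hsm n (z i ω) (hω i)) hint)
    (fun i => differentiableAt_of_contDiffOn_two hN (hC (z i ω) (hω i)) hθN) hlow
    (fun i => hδ.trans_le (hδf _ (hω i) _ hmemΘ)) hval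
    (fun i => norm_gradient_sub_le_of_approxError herr hen0 (hω i) hint)
    (fun i => hωb i _ hθN) hmaxω
  calc √(n : ℝ) * ‖(n : ℝ)⁻¹ • ∑ i ∈ Finset.range n,
        gradient (fun θ => Real.log (f (z i ω) θ)) (θhat n ω)‖
      ≤ √(n : ℝ) * (e / √(n : ℝ) / (δ / 2) * (1 + B)) := by
        gcongr
        exact hscore.trans (by gcongr)
    _ = e * (2 * (1 + B) / δ) := by field_simp
    _ ≤ ε * δ / (4 * (1 + B)) * (2 * (1 + B) / δ) := by gcongr; exact min_le_right _ _
    _ = ε / 2 := by field_simp; norm_num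
    _ < ε := half_lt_self hε

/-- On a ball, an envelope of the Hessian yields one of the gradient. -/
lemma exists_integrable_gradient_envelope {S : Type*} [MeasurableSpace S] {μ : Measure S}
    [IsFiniteMeasure μ] {s : S → EuclideanSpace ℝ (Fin p) → EuclideanSpace ℝ (Fin p)}
    {D : S → EuclideanSpace ℝ (Fin p) →
      EuclideanSpace ℝ (Fin p) →L[ℝ] EuclideanSpace ℝ (Fin p)} {ρ : ℝ}
    (hs : Integrable (fun x => s x θ₀) μ)
    (hD : ∀ᵐ x ∂μ, ∀ θ ∈ Metric.ball θ₀ ρ, HasFDerivAt (s x) (D x θ) θ)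
    {b : S → ℝ} (hb : Integrable b μ) (hDb : ∀ᵐ x ∂μ, ∀ θ ∈ Metric.ball θ₀ ρ, ‖D x θ‖ ≤ b x) :
    ∃ b' : S → ℝ, Integrable b' μ ∧ ∀ᵐ x ∂μ, ∀ θ ∈ Metric.ball θ₀ ρ, ‖s x θ‖ ≤ b' x := by
  refine ⟨fun x => ‖s x θ₀‖ + b x * ρ, hs.norm.add (hb.mul_const ρ), ?_⟩
  filter_upwards [hD, hDb] with x hx hxb θ hθ
  have hρ : 0 < ρ := dist_nonneg.trans_lt hθ
  have hθ₀ : θ₀ ∈ Metric.ball θ₀ ρ := Metric.mem_ball_self hρ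
  have h1 := (convex_ball θ₀ ρ).norm_image_sub_le_of_norm_hasFDerivWithin_le
    (fun y hy => (hx y hy).hasFDerivWithinAt) hxb hθ₀ hθ
  have h2 : b x * ‖θ - θ₀‖ ≤ b x * ρ := by
    have : 0 ≤ b x := (norm_nonneg _).trans (hxb θ₀ hθ₀)
    gcongr
    exact (mem_ball_iff_norm.1 hθ).le
  have h3 := norm_add_le (s x θ₀) (s x θ - s x θ₀)
  rw [add_sub_cancel] at h3
  linarith

end Estimator

/-- The normalized sums of the scores, multiplied by the inverse information, are asymptotically
normal with the inverse information as covariance. -/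
lemma tendstoInDistribution_inv_information_score {d p : ℕ} {Ω : Type*} [MeasurableSpace Ω]
    {P : Measure Ω} [IsProbabilityMeasure P] {μ : Measure (EuclideanSpace ℝ (Fin d))}
    [IsProbabilityMeasure μ]
    {s : EuclideanSpace ℝ (Fin d) → EuclideanSpace ℝ (Fin p)}
    {z : ℕ → Ω → EuclideanSpace ℝ (Fin d)}
    (hz_law : ∀ i, HasLaw (z i) μ P) (hz_indep : iIndepFun z P)
    (hs : AEStronglyMeasurable s μ)
    (hL2 : ∀ i j, Integrable (fun x => s x i * s x j) μ) (hmean : ∫ x, s x ∂μ = 0)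
    {V : Matrix (Fin p) (Fin p) ℝ} (hV : V = Matrix.of fun i j => ∫ x, s x i * s x j ∂μ)
    (hdet : V.det ≠ 0) :
    TendstoInDistribution (fun (n : ℕ) ω => (√(n : ℝ))⁻¹ • ∑ k ∈ Finset.range n,
      Matrix.toEuclideanCLM (𝕜 := ℝ) V⁻¹ (s (z k ω))) atTop id
      (fun _ => P) (multivariateGaussian 0 V⁻¹) := by
  set J := Matrix.toEuclideanCLM (𝕜 := ℝ) V⁻¹ with hJ
  have hVpsd : V.PosSemidef := hV ▸ posSemidef_integral_mul hL2
  have hmem : MemLp s 2 μ := memLp_two_of_integrable_mul hs fun i => hL2 i i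
  have hJs : AEStronglyMeasurable (fun x => J (s x)) μ := J.continuous.comp_aestronglyMeasurable hs
  have hJsP : ∀ i, AEMeasurable (fun x => J (s x)) (P.map (z i)) := fun i => by
    rw [(hz_law i).map_eq]; exact hJs.aemeasurable
  have hJL2 : MemLp (fun x => J (s x)) 2 (P.map (z 0)) := by
    rw [(hz_law 0).map_eq]; exact J.comp_memLp' hmem
  have hid : ∀ i, IdentDistrib (z i) (z 0) P P := fun i =>
    ⟨(hz_law i).aemeasurable, (hz_law 0).aemeasurable,
      (hz_law i).map_eq.trans (hz_law 0).map_eq.symm⟩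
  refine tendstoInDistribution_inv_sqrt_smul_sum (X := fun k ω => J (s (z k ω)))
    (hz_indep.comp₀ (fun _ x => J (s x)) (fun i => (hz_law i).aemeasurable) hJsP)
    (fun i => (hid i).comp_of_aemeasurable (hJsP i))
    (hJL2.comp_of_map (hz_law 0).aemeasurable) ?_ hVpsd.inv fun t => ?_
  · have h := integral_map (hz_law 0).aemeasurable hJL2.aestronglyMeasurable
    rw [← h, (hz_law 0).map_eq, J.integral_comp_comm (hmem.integrable one_le_two), hmean, map_zero]
  · have hJL2t : AEStronglyMeasurable (fun x => inner ℝ (J (s x)) t ^ 2) (P.map (z 0)) :=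
      (hJL2.aestronglyMeasurable.inner aestronglyMeasurable_const).pow 2
    have h := integral_map (hz_law 0).aemeasurable hJL2t
    -- `J` is symmetric, so the quadratic form at `t` is that of `V` at `J t = V⁻¹ t`.
    have hsymm : ∀ x, inner ℝ (J (s x)) t = inner ℝ (s x) (J t) := by
      intro x
      have hherm : V⁻¹.transpose = V⁻¹ := by
        have := hVpsd.inv.isHermitian.eq
        rwa [Matrix.conjTranspose_eq_transpose_of_trivial] at this
      rw [real_inner_comm, hJ, Matrix.inner_toEuclideanCLM, Matrix.inner_toEuclideanCLM,
        Matrix.dotProduct_mulVec, ← Matrix.mulVec_transpose, hherm, dotProduct_comm]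
    rw [← h, (hz_law 0).map_eq]
    simp only [hsymm]
    rw [integral_inner_sq hL2, ← hV, hJ, Matrix.ofLp_toEuclideanCLM, Matrix.mulVec_mulVec,
      Matrix.mul_nonsing_inv _ (isUnit_iff_ne_zero.2 hdet), Matrix.one_mulVec, dotProduct_comm]

theorem theorem8 {d p : ℕ} {Ω : Type*} [MeasurableSpace Ω] (P : Measure Ω)
    [IsProbabilityMeasure P]
    -- the model: densities `f z θ` on `Z ⊆ ℝ^d` with respect to `ν`, true parameter `θ₀`
    (ν : Measure (EuclideanSpace ℝ (Fin d))) (Z : Set (EuclideanSpace ℝ (Fin d)))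
    (Θ : Set (EuclideanSpace ℝ (Fin p)))
    (f : EuclideanSpace ℝ (Fin d) → EuclideanSpace ℝ (Fin p) → ℝ)
    (θ₀ : EuclideanSpace ℝ (Fin p))
    (hf : IsDensityFamily ν Z Θ f)
    -- the i.i.d. sample
    (z : ℕ → Ω → EuclideanSpace ℝ (Fin d))
    (hz_law : ∀ i, HasLaw (z i) (modelLaw ν Z f θ₀) P)
    (hz_indep : iIndepFun z P)
    -- the (possibly random) approximations with accuracy parameter `r`, and the choice `r = R n`
    (ft : ℕ → Ω → EuclideanSpace ℝ (Fin d) → EuclideanSpace ℝ (Fin p) → ℝ) (R : ℕ → ℕ)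
    -- the maximum approximated likelihood estimator
    (θhat : ℕ → Ω → EuclideanSpace ℝ (Fin p))
    (hθ_meas : ∀ n, AEMeasurable (θhat n) P)
    (hθ_max : Tendsto (fun n => P {ω | ¬ (θhat n ω ∈ Θ ∧
      IsMaxOn (logLikelihood (ft (R n) ω) (fun i => z i ω) n) Θ (θhat n ω))}) atTop (𝓝 0))
    -- the standing conditions
    (hML : MLNormalityConditions ν Z Θ f θ₀)
    (hMAL : MALConsistencyConditions P ν Z Θ f θ₀ ft R)
    -- (i) the approximations are twice continuously differentiable and bounded in `θ`
    (h_smooth : ∀ᵐ ω ∂P, ∀ r, ∀ x ∈ Z, ContinuousOn (ft r ω x) Θ ∧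
      ContDiffOn ℝ 2 (ft r ω x) (interior Θ) ∧ ∃ C : ℝ, ∀ θ ∈ Θ, |ft r ω x θ| ≤ C)
    -- (ii) the error in value and gradient is `o(n^{-1/2})` in probability
    (h_rate : TendstoInMeasure P
      (fun (n : ℕ) ω => ENNReal.ofReal (Real.sqrt n) * approxError Z Θ (ft (R n) ω) f)
      atTop (fun _ => 0))
    -- (iii) the error in the Hessian tends to zero in probability
    (h_hess : TendstoInMeasure P (fun n ω => hessianError Z Θ (ft (R n) ω) f)
      atTop (fun _ => 0)) :
    TendstoInDistribution (fun (n : ℕ) ω => Real.sqrt n • (θhat n ω - θ₀)) atTop id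
      (fun _ => P) (multivariateGaussian 0 (fisherInformation ν Z f θ₀)⁻¹) := by
  obtain ⟨N₀, hN₀, hθN₀, hN₀Θ, hC₀, hpos₀, hgrad, hhess, hhesslog⟩ := hML.neighbourhood
  obtain ⟨δ, hδ, hδf⟩ := hMAL.bounded_below
  set μ := modelLaw ν Z f θ₀ with hμ
  have hμprob : IsProbabilityMeasure μ := by
    rw [← (hz_law 0).map_eq]
    exact Measure.isProbabilityMeasure_map (hz_law 0).aemeasurable
  have hZ : ∀ᵐ x ∂μ, x ∈ Z := hf.ae_modelLaw_mem
  -- Regularity of the log-likelihood of a single observation near `θ₀`.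
  have hClog : ∀ᵐ x ∂μ, ContDiffOn ℝ 2 (fun θ => Real.log (f x θ)) N₀ := hZ.mono fun x hx =>
    (hC₀ x hx).log fun θ hθ => (hpos₀ x hx θ hθ).ne'
  have hmlog : ∀ θ ∈ N₀, AEStronglyMeasurable (fun x => Real.log (f x θ)) μ := fun θ hθ =>
    ((hf.aemeasurable θ (hN₀Θ hθ)).mono_ac modelLaw_absolutelyContinuous).log.aestronglyMeasurable
  have hDm : ∀ θ ∈ N₀, AEStronglyMeasurable
      (fun x => hessian (fun θ' => Real.log (f x θ')) θ) μ := fun θ hθ =>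
    aestronglyMeasurable_hessian hN₀ hmlog hClog hθ
  have hDc : ∀ᵐ x ∂μ, ContinuousOn (hessian (fun θ' => Real.log (f x θ'))) N₀ :=
    hClog.mono fun x hx => continuousOn_hessian hN₀ hx
  have hD : ∀ᵐ x ∂μ, ∀ θ ∈ N₀, HasFDerivAt (gradient (fun θ' => Real.log (f x θ')))
      (hessian (fun θ' => Real.log (f x θ')) θ) θ :=
    hClog.mono fun x hx θ hθ => hasFDerivAt_gradient hN₀ hx hθ
  obtain ⟨b, hb, hDb⟩ := exists_integrable_of_lintegral_biSup
    (g := fun x θ => hessian (fun θ' => Real.log (f x θ')) θ) hDc hDm hhesslog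
  have hsm : AEStronglyMeasurable (fun x => gradient (fun θ => Real.log (f x θ)) θ₀) μ :=
    aestronglyMeasurable_gradient hN₀ hmlog hClog hθN₀
  have hsL2 : MemLp (fun x => gradient (fun θ => Real.log (f x θ)) θ₀) 2 μ :=
    memLp_two_of_integrable_mul hsm fun i => hML.information_exists i i
  obtain ⟨ρ, hρ, hρN⟩ := Metric.isOpen_iff.1 hN₀ θ₀ hθN₀
  obtain ⟨b', hb', hsb⟩ := exists_integrable_gradient_envelope (hsL2.integrable one_le_two)
    (hD.mono fun x hx θ hθ => hx θ (hρN hθ)) hb (hDb.mono fun x hx θ hθ => hx θ (hρN hθ))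
  -- The estimator is consistent and an asymptotic root of the likelihood equation.
  have hcons : ∀ ε > 0, WithHighProb P (fun n ω => dist (θhat n ω) θ₀ < ε) := fun ε hε =>
    withHighProb_dist_lt_of_isMaxOn hf hz_law hz_indep hML.consistency hδ hδf
      (h_smooth.mono fun ω h n x hx => (h (R n) x hx).1) h_rate hθ_max hε
  have hroot : ∀ ε > 0, WithHighProb P (fun n ω => √(n : ℝ) * ‖(n : ℝ)⁻¹ •
      ∑ i ∈ Finset.range n, gradient (fun θ => Real.log (f (z i ω) θ)) (θhat n ω)‖ < ε) :=
    fun ε hε => withHighProb_sqrt_mul_norm_average_score_lt hf hz_law hz_indep hδ hδf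
      Metric.isOpen_ball (hρN.trans hN₀Θ) (fun x hx => (hC₀ x hx).mono hρN)
      (h_smooth.mono fun ω h n x hx => (h (R n) x hx).2.1) h_rate hθ_max (hcons ρ hρ) hb' hsb hε
  -- The information equality and the central limit theorem for the scores.
  set V := fisherInformation ν Z f θ₀ with hV
  have hJ : ∀ v, Matrix.toEuclideanCLM (𝕜 := ℝ) V⁻¹
      ((∫ x, hessian (fun θ => Real.log (f x θ)) θ₀ ∂μ) v) = -v := by
    intro v
    rw [integral_hessian_log_apply hf hN₀ hN₀Θ hθN₀ hC₀ hpos₀ hgrad hhess hML.information_exists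
      (hb.mono' (hDm θ₀ hθN₀) (hDb.mono fun x hx => hx θ₀ hθN₀)), map_neg,
      ← mul_apply_eq_comp, ← map_mul,
      Matrix.nonsing_inv_mul _ (isUnit_iff_ne_zero.2 hML.information_nonsingular), map_one,
      one_apply_eq_self]
  have hclt := tendstoInDistribution_inv_information_score hz_law hz_indep hsm
    hML.information_exists
    (integral_score_eq_zero hf hN₀ hN₀Θ hθN₀ hC₀ hpos₀ hgrad) (V := V) rfl
    hML.information_nonsingular
  refine tendstoInDistribution_of_tendstoInMeasure_sub _ _ hclt ?_
    fun n => by have := hθ_meas n; fun_prop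
  rw [tendstoInMeasure_iff_norm]
  intro η hη
  have hexp := withHighProb_norm_sqrt_smul_sub_lt hz_law hz_indep hN₀ hθN₀ hD hDc hDm hb hDb hJ
    hcons hroot (fun τ hτ => exists_eventually_measure_le_of_tendstoInDistribution hclt hτ) hη
  simpa only [WithHighProb, not_lt, Pi.sub_apply, Pi.zero_apply, sub_zero] using hexp
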